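/- Let $k$ be a nonarchimedean local field (of any characteristic), and let $\mathbf{C}$ be the completion of an algebraic closure of $k$. Let $S$ be a finite set, and for every $\mathfrak{p}\in S$ let $F_\mathfrak{p}$ be a nonarchimedean local field with valuation ring $\mathcal{O}_\mathfrak{p}$ and with a continuous embedding $\iota_\mathfrak{p}\colon F_\mathfrak{p}\hookrightarrow\mathbf{C}$. Put $F_S=\prod_{\mathfrak{p}\in S}F_\mathfrak{p}$. The group $\mathrm{PGL}_2(F_S)=\prod_{\mathfrak{p}\in S}\mathrm{PGL}_2(F_\mathfrak{p})$ acts on $\mathbb{P}^1(\mathbf{C})^S$ through the $\iota_\mathfrak{p}$. For a subgroup $\Gamma\subseteq\mathrm{PGL}_2(F_S)$ let $\mathcal{L}_\Gamma\subseteq\mathbb{P}^1(\mathbf{C})^S$ be its set of limit points: the points $x$ for which there are a point $y\in\mathbb{P}^1(\mathbf{C})^S$ and pairwise distinct $\gamma_1,\gamma_2,\ldots\in\Gamma$ with $\gamma_j(y)\to x$. The group $\Gamma$ is called *plectic* if there are subsets $\mathcal{L}_{\Gamma,\mathfrak{p}}\subseteq\mathbb{P}^1(F_\mathfrak{p})$,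 $\mathfrak{p}\in S$ (which are then unique), such that $$\mathcal{L}_\Gamma=\bigcup_{\mathfrak{p}\in S}\Big(\mathcal{L}_{\Gamma,\mathfrak{p}}\times\mathbb{P}^1(\mathbf{C})^{S\setminus\{\mathfrak{p}\}}\Big),$$ and a plectic group is called *semi-simple* if no $\mathcal{L}_{\Gamma,\mathfrak{p}}$ has exactly one element. In that case let $\mathcal{T}_{\Gamma,\mathfrak{p}}$ be a single point if $\mathcal{L}_{\Gamma,\mathfrak{p}}=\emptyset$, and otherwise the subtree of the Bruhat--Tits tree of $\mathrm{PGL}_2(F_\mathfrak{p})$ that is the union of all infinite geodesics joining two distinct points of $\mathcal{L}_{\Gamma,\mathfrak{p}}$, where $\mathbb{P}^1(F_\mathfrak{p})$ is identified with the set of ends of the tree. The group $\Gamma$ acts on the polysimplicial complex $\mathcal{T}_\Gamma=\prod_{\mathfrak{p}\in S}\mathcal{T}_{\Gamma,\mathfrak{p}}$, and a semi-simple plectic group $\Gamma$ is called *normal* if the quotient $\Gamma\backslash\mathcal{T}_\Gamma$ is finite, i.e. if there are only finitely many $\Gamma$-orbits of polysimplices of $\mathcal{T}_\Gamma$. **Proposition.**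 Every normal plectic subgroup $\Gamma$ of $\mathrm{PGL}_2(F_S)$ is virtually torsion-free, i.e. it has a torsion-free subgroup of finite index. Moreover, $\Gamma$ is of type (WFL), i.e. it is virtually torsion-free and every torsion-free subgroup $\Gamma'\subseteq\Gamma$ of finite index is of type (FL): the trivial $\mathbb{Z}[\Gamma']$-module $\mathbb{Z}$ has a resolution of finite length by free $\mathbb{Z}[\Gamma']$-modules of finite rank. -/

import Mathlib

open Topology Filter
open scoped MatrixGroups LinearAlgebra.Projectivization ValuativeRel

noncomputable section

namespace Plectic

/-! ### The completed algebraic closure of a complete nonarchimedean field -/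

section CompletedAlgClosure

variable (k : Type*) [NontriviallyNormedField k] [IsUltrametricDist k] [CompleteSpace k]

/-- An algebraic closure of `k`, to be equipped with the extension of the absolute value of `k`. -/
def AlgCl : Type _ := AlgebraicClosure k

/-- The unique extension of the absolute value of `k` to the algebraic closure. -/
instance : NormedField (AlgCl k) := spectralNorm.normedField k (AlgebraicClosure k)

/-- The completion of an algebraic closure of `k`. -/
abbrev CompletedAlgClosure : Type _ := UniformSpace.Completion (AlgCl k)

end CompletedAlgClosure

/-! ### Projective lines -/

/-- The topology of the projective line over a topological field: the quotient topology from the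
space of nonzero vectors. -/
instance projLineTopology (K : Type*) [Field K] [TopologicalSpace K] :
    TopologicalSpace (ℙ K (Fin 2 → K)) :=
  TopologicalSpace.coinduced (Projectivization.mk' K) inferInstance

section ProjLine

variable {K C : Type*} [Field K] [Field C]

/-- A homomorphism of fields, applied to the coordinates of vectors, as a semilinear map. -/
def coordMap (f : K →+* C) : (Fin 2 → K) →ₛₗ[f] (Fin 2 → C) where
  toFun v j := f (v j)
  map_add' v w := by ext j; simp
  map_smul' a v := by ext j; simp

lemma coordMap_injective (f : K →+* C) : Function.Injective (coordMap f) :=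
  fun _ _ h => funext fun j => f.injective (congrFun h j)

/-- The map `ℙ¹(K) → ℙ¹(C)` induced by a homomorphism of fields `K → C`. -/
def projLineMap (f : K →+* C) : ℙ K (Fin 2 → K) → ℙ C (Fin 2 → C) :=
  Projectivization.map (coordMap f) (coordMap_injective f)

variable (K)

/-- The point `∞ = [1 : 0]`. -/
def projInfty : ℙ K (Fin 2 → K) :=
  Projectivization.mk K ![1, 0] (by simp)

/-- The point `0 = [0 : 1]`. -/
def projZero : ℙ K (Fin 2 → K) :=
  Projectivization.mk K ![0, 1] (by simp)

end ProjLine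

/-! ### The Bruhat–Tits tree of `PGL₂(F)` and the subtree attached to a set of ends -/

section Tree

variable (F : Type*) [Field F] [ValuativeRel F]

/-- The subgroup `PGL₂(𝒪)` of `PGL₂(F)`, where `𝒪` is the valuation ring of `F`. -/
def maxCompact : Subgroup PGL(2, F) :=
  (Matrix.ProjGenLinGroup.map (n := Fin 2) (algebraMap 𝒪[F] F)).range

/-- The vertices of the Bruhat–Tits tree: the coset of (the class of) `g` corresponds to the
homothety class of the lattice `g 𝒪²`, that is the lattice spanned by the columns of `g`. -/
abbrev Vertex : Type _ := PGL(2, F) ⧸ maxCompact F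

/-- The Bruhat–Tits tree of `PGL₂(F)`. The vertices `g PGL₂(𝒪)` and `g diag(ϖ, 1) PGL₂(𝒪)` are
neighbours for all `g` and all uniformizers `ϖ`: these are the pairs of homothety classes with
representatives `Λ' ⊆ Λ` such that `Λ / Λ'` is a one-dimensional vector space over the residue
field. -/
def bruhatTitsTree : SimpleGraph (Vertex F) :=
  SimpleGraph.fromRel fun x y => ∃ (ϖ : 𝒪[F]) (g d : GL (Fin 2) F),
    Irreducible ϖ ∧ (d : Matrix (Fin 2) (Fin 2) F) = !![(ϖ : F), 0; 0, 1] ∧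
    x = (Matrix.ProjGenLinGroup.mk g : PGL(2, F)) ∧
    y = (Matrix.ProjGenLinGroup.mk (g * d) : PGL(2, F))

variable {F}

/-- The vertices on the infinite geodesic of the Bruhat–Tits tree with the ends `a ≠ b` in `ℙ¹(F)`:
the homothety classes of the lattices `𝒪 v + 𝒪 w` with `v` and `w` nonzero vectors on the lines `a`
and `b`. -/
def geodesic (a b : ℙ F (Fin 2 → F)) : Set (Vertex F) :=
  {x | ∃ g : PGL(2, F), g • projInfty F = a ∧ g • projZero F = b ∧ x = (g : Vertex F)}

/-- The vertices of the subtree attached to a set `L` of at least two ends: the union of all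
geodesics between two different ends in `L`. If `L` has two elements, this is the geodesic joining
them; if `L` is perfect, it is the smallest subtree whose set of ends is `L`. -/
def limitTree (L : Set (ℙ F (Fin 2 → F))) : Set (Vertex F) :=
  {x | ∃ a ∈ L, ∃ b ∈ L, a ≠ b ∧ x ∈ geodesic a b}

/-- The simplices (vertices and edges, given by their sets of vertices) of that subtree. -/
def limitTreeSimplices (L : Set (ℙ F (Fin 2 → F))) : Set (Set (Vertex F)) :=
  {s | s ⊆ limitTree L ∧
    ((∃ x, s = {x}) ∨ ∃ x y, (bruhatTitsTree F).Adj x y ∧ s = {x, y})}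

end Tree

/-! ### Plectic groups -/

section PlecticGroups

variable {S : Type*} {F : S → Type*} [∀ i, Field (F i)] {C : Type*} [Field C]

/-- The set of limit points in `ℙ¹(C)^S` of a subgroup of `∏ PGL₂(F i)`, which acts through the
embeddings `ι i : F i → C`. -/
def limitSet [TopologicalSpace C] (ι : ∀ i, F i →+* C) (Γ : Subgroup (∀ i, PGL(2, F i))) :
    Set (S → ℙ C (Fin 2 → C)) :=
  {x | ∃ (y : S → ℙ C (Fin 2 → C)) (γ : ℕ → ∀ i, PGL(2, F i)),
    Function.Injective γ ∧ (∀ j, γ j ∈ Γ) ∧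
    Tendsto (fun j i => Matrix.ProjGenLinGroup.map (ι i) (γ j i) • y i) atTop (𝓝 x)}

/-- `Γ` is plectic, with the sets `L i ⊆ ℙ¹(F i)`: the limit set of `Γ` is the union over `i` of the
sets of all points whose `i`-th coordinate lies in `L i`. -/
def IsPlecticWith [TopologicalSpace C] (ι : ∀ i, F i →+* C) (Γ : Subgroup (∀ i, PGL(2, F i)))
    (L : ∀ i, Set (ℙ (F i) (Fin 2 → F i))) : Prop :=
  limitSet ι Γ = {x | ∃ i, x i ∈ projLineMap (ι i) '' L i}

variable [∀ i, ValuativeRel (F i)]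

/-- The polysimplices of the product over all `i` of the trees attached to the sets `L i`. If `L i`
is empty, then the `i`-th tree is a single point, and the factor is left out. -/
def polysimplices (L : ∀ i, Set (ℙ (F i) (Fin 2 → F i))) :
    Set (∀ i : {i // (L i).Nonempty}, Set (Vertex (F i))) :=
  {c | ∀ i : {i // (L i).Nonempty}, c i ∈ limitTreeSimplices (L i)}

/-- The `Γ`-orbit of a tuple of sets of vertices. -/
def polyOrbit (Γ : Subgroup (∀ i, PGL(2, F i))) {L : ∀ i, Set (ℙ (F i) (Fin 2 → F i))}
    (c : ∀ i : {i // (L i).Nonempty}, Set (Vertex (F i))) :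
    Set (∀ i : {i // (L i).Nonempty}, Set (Vertex (F i))) :=
  {c' | ∃ γ ∈ Γ, ∀ i : {i // (L i).Nonempty}, c' i = (fun x : Vertex (F i) => γ i • x) '' c i}

/-- Normal plectic subgroups: `Γ` is plectic, semi-simple (no `L i` has exactly one element), and
there are only finitely many `Γ`-orbits of polysimplices. -/
def IsNormalPlectic [TopologicalSpace C] (ι : ∀ i, F i →+* C)
    (Γ : Subgroup (∀ i, PGL(2, F i))) : Prop :=
  ∃ L : ∀ i, Set (ℙ (F i) (Fin 2 → F i)),
    IsPlecticWith ι Γ L ∧ (∀ i x, L i ≠ {x}) ∧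
    (polyOrbit Γ '' polysimplices L).Finite

end PlecticGroups

/-! ### Finiteness properties of groups -/

section Finiteness

variable (G : Type*) [Group G]

/-- The only element of finite order is the unit element. -/
def IsTorsionFreeGroup : Prop := ∀ g : G, IsOfFinOrder g → g = 1

/-- Some subgroup of finite index is torsion-free. -/
def IsVirtuallyTorsionFree : Prop :=
  ∃ H : Subgroup G, H.FiniteIndex ∧ IsTorsionFreeGroup H

/-- `G` is of type (FL): the trivial `ℤ[G]`-module `ℤ` has a resolution of finite length
`0 → ℤ[G]^(r n) → ⋯ → ℤ[G]^(r 0) → ℤ → 0` by free modules of finite rank. -/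
def IsTypeFL : Prop :=
  ∃ (n : ℕ) (r : ℕ → ℕ)
    (d : ∀ i, (Fin (r (i + 1)) → MonoidAlgebra ℤ G) →ₗ[MonoidAlgebra ℤ G]
      (Fin (r i) → MonoidAlgebra ℤ G))
    (ε : (Fin (r 0) → MonoidAlgebra ℤ G) →ₗ[MonoidAlgebra ℤ G]
      (Representation.trivial ℤ G ℤ).asModule),
    (∀ i, n < i → r i = 0) ∧ Function.Surjective ε ∧ Function.Exact (d 0) ε ∧
    ∀ i, Function.Exact (d (i + 1)) (d i)

/-- `G` is of type (WFL): it is virtually torsion-free, and each of its torsion-free subgroups of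
finite index is of type (FL). -/
def IsTypeWFL : Prop :=
  IsVirtuallyTorsionFree G ∧
    ∀ H : Subgroup G, H.FiniteIndex → IsTorsionFreeGroup H → IsTypeFL H

end Finiteness

end Plectic

end

/-! Let `Γ` act on the product of the trees attached to the nonempty sets `L i`. Everything follows
from this action being proper and cocompact (`IsProperCocompact`). Cocompactness is the normality
hypothesis. For properness (`IsPlecticWith.finite_transporter`), suppose that infinitely many
elements of `Γ` take one tuple of vertices to another. Up to fixed factors they come from `GL₂(𝒪)`,
which is compact, so a subsequence applied to a suitable point of `ℙ¹(C)^S` converges. Coordinates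
with `L i` nonempty start at points not rational over `F i`, and the limits are not rational either.
The limit point then lies in no piece of the limit set, a contradiction. Such points exist because
`F i` does not fill `C` (`exists_notMem_range_completedAlgClosure`).

Sending a vertex towards a fixed end gives a parent map (`exists_isParentMap`), from which the
barycentric subdivision of each tree is seen to be an acyclic one-dimensional complex. Such a
subdivision has a canonical orientation, so automorphisms never invert an edge. An element of prime
order fixes a simplex in each tree (`IsAcyclicComplex.exists_fixed`), and by cocompactness and
properness the elements that fix a polysimplex lie in finitely many conjugacy classes.

Connectedness of the product makes `Γ` finitely generated (`IsProperCocompact.fg`). Hence its images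
in the groups `PGL₂(F i)` are residually finite by reduction modulo maximal ideals of finitely
generated domains, in any characteristic (`exists_normal_finiteIndex_notMem`). A normal subgroup of
finite index that avoids the finitely many nontrivial classes contains no element of prime order, so
it is torsion-free.

A torsion-free subgroup of finite index acts freely on the cells, with finitely many orbits. The
chain complexes of the trees are used one factor at a time: each presents `ℤ[Y]` as the cokernel of
an injection `ℤ[Y × B] → ℤ[Y × A]`, and cokernels of injections preserve finite free resolutions
(`HasFiniteFreeRes.cokernel`). With `Y` a point this gives type (FL). -/

namespace Plectic

/-! ### Modules with a finite resolution by free modules of finite rank -/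

section FiniteFreeResolution

universe w v v₁ v₂ v₃

variable (R : Type w) [Ring R]

/-- A module in the universe of the ring with a resolution of length less than `n` by free modules
of finite rank. -/
def HasFiniteFreeResAux : ℕ → ∀ (M : Type w) [AddCommGroup M] [Module R M], Prop
  | 0, M, _, _ => Subsingleton M
  | n + 1, M, _, _ => ∃ (r : ℕ) (f : (Fin r → R) →ₗ[R] M), Function.Surjective f ∧
      HasFiniteFreeResAux n (LinearMap.ker f)

/-- A module with a resolution of length at most `n` by free modules of finite rank. -/
def HasFiniteFreeRes (n : ℕ) (M : Type v) [AddCommGroup M] [Module R M] : Prop :=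
  ∃ (r : ℕ) (f : (Fin r → R) →ₗ[R] M), Function.Surjective f ∧
    HasFiniteFreeResAux R n (LinearMap.ker f)

variable {R}

lemma HasFiniteFreeResAux.succ : ∀ {n : ℕ} {M : Type w} [AddCommGroup M] [Module R M],
    HasFiniteFreeResAux R n M → HasFiniteFreeResAux R (n + 1) M
  | 0, M, _, _, h => by
    have : Subsingleton M := h
    exact ⟨0, 0, fun x => ⟨0, Subsingleton.elim _ _⟩,
      (inferInstance : Subsingleton (LinearMap.ker (0 : (Fin 0 → R) →ₗ[R] M)))⟩
  | n + 1, M, _, _, ⟨r, f, hf, h⟩ => ⟨r, f, hf, h.succ⟩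

lemma HasFiniteFreeRes.succ {n : ℕ} {M : Type v} [AddCommGroup M] [Module R M]
    (h : HasFiniteFreeRes R n M) : HasFiniteFreeRes R (n + 1) M := by
  obtain ⟨r, f, hf, h⟩ := h
  exact ⟨r, f, hf, h.succ⟩

lemma HasFiniteFreeRes.mono {m n : ℕ} (hmn : m ≤ n) {M : Type v} [AddCommGroup M] [Module R M]
    (h : HasFiniteFreeRes R m M) : HasFiniteFreeRes R n M := by
  induction n, hmn using Nat.le_induction with
  | base => exact h
  | succ n _ ih => exact ih.succ

lemma HasFiniteFreeResAux.of_equiv {n : ℕ} {M N : Type w} [AddCommGroup M] [Module R M]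
    [AddCommGroup N] [Module R N] (e : M ≃ₗ[R] N) (h : HasFiniteFreeResAux R n M) :
    HasFiniteFreeResAux R n N := by
  cases n with
  | zero =>
    have : Subsingleton M := h
    exact e.symm.injective.subsingleton
  | succ n =>
    obtain ⟨r, f, hf, h⟩ := h
    refine ⟨r, e.toLinearMap ∘ₗ f, e.surjective.comp hf, ?_⟩
    rwa [LinearEquiv.ker_comp]

lemma HasFiniteFreeRes.of_equiv {n : ℕ} {M : Type v₁} {N : Type v₂} [AddCommGroup M] [Module R M]
    [AddCommGroup N] [Module R N] (e : M ≃ₗ[R] N) (h : HasFiniteFreeRes R n M) :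
    HasFiniteFreeRes R n N := by
  obtain ⟨r, f, hf, h⟩ := h
  refine ⟨r, e.toLinearMap ∘ₗ f, e.surjective.comp hf, ?_⟩
  rwa [LinearEquiv.ker_comp]

/-- The extension property for a given length, for modules in the universe of the ring. -/
def ExtensionProperty (R : Type w) [Ring R] (n : ℕ) : Prop :=
  ∀ (X Y Z : Type w) [AddCommGroup X] [AddCommGroup Y] [AddCommGroup Z] [Module R X] [Module R Y]
    [Module R Z] (a : X →ₗ[R] Y) (b : Y →ₗ[R] Z), Function.Injective a → Function.Exact a b →
    Function.Surjective b → HasFiniteFreeResAux R n X → HasFiniteFreeResAux R n Z →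
    HasFiniteFreeResAux R n Y

/-- Horseshoe lemma: a cover of `Z` lifts to `Y` and combines with a cover of `X`, and the three
kernels again form a short exact sequence. These kernels live in the universe of `R` even if `X`,
`Y`, `Z` do not, so `ext` applies to them. -/
lemma ExtensionProperty.extension {n : ℕ} (ext : ExtensionProperty R n)
    {X : Type v₁} {Y : Type v₂} {Z : Type v₃} [AddCommGroup X] [AddCommGroup Y] [AddCommGroup Z]
    [Module R X] [Module R Y] [Module R Z] (a : X →ₗ[R] Y) (b : Y →ₗ[R] Z)
    (ha : Function.Injective a) (hab : Function.Exact a b) (hb : Function.Surjective b)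
    (hX : HasFiniteFreeRes R n X) (hZ : HasFiniteFreeRes R n Z) : HasFiniteFreeRes R n Y := by
  obtain ⟨r, f, hf, hkf⟩ := hX
  obtain ⟨s, g, hg, hkg⟩ := hZ
  obtain ⟨g', hg'⟩ := Module.projective_lifting_property b g hb
  let e : (Fin (r + s) → R) ≃ₗ[R] (Fin r → R) × (Fin s → R) :=
    (LinearEquiv.funCongrLeft R R finSumFinEquiv) ≪≫ₗ LinearEquiv.sumArrowLequivProdArrow _ _ R R
  let h : (Fin r → R) × (Fin s → R) →ₗ[R] Y := LinearMap.coprod (a ∘ₗ f) g'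
  have hbg : ∀ y, b (g' y) = g y := fun y => LinearMap.congr_fun hg' y
  have hba : ∀ x, b (a x) = 0 := fun x => (hab _).2 ⟨x, rfl⟩
  have hh : Function.Surjective h := by
    intro y
    obtain ⟨z, hz⟩ := hg (b y)
    have : b (y - g' z) = 0 := by rw [map_sub, hbg, hz, sub_self]
    obtain ⟨x, hx⟩ := (hab _).1 this
    obtain ⟨x', rfl⟩ := hf x
    exact ⟨(x', z), by simp [h, hx]⟩
  let i : LinearMap.ker f →ₗ[R] LinearMap.ker h :=
    (LinearMap.inl R _ _).restrict (fun x hx => by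
      have hx' : f x = 0 := hx
      simp [h, hx'])
  let j : LinearMap.ker h →ₗ[R] LinearMap.ker g :=
    (LinearMap.snd R _ _).restrict (fun x hx => by
      have hx' : a (f x.1) + g' x.2 = 0 := hx
      have := congrArg b hx'
      rw [map_add, hba, zero_add, hbg, map_zero] at this
      exact this)
  have key : HasFiniteFreeResAux R n (LinearMap.ker h) := by
    refine ext _ _ _ i j ?_ ?_ ?_ hkf hkg
    · intro x y hxy
      have := congrArg (fun z : LinearMap.ker h => z.1.1) hxy
      exact Subtype.ext this
    · rintro ⟨⟨x, z⟩, hxz⟩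
      constructor
      · intro hz
        have hz' : z = 0 := congrArg Subtype.val hz
        subst hz'
        have hx' : a (f x) + g' 0 = 0 := hxz
        rw [map_zero, add_zero] at hx'
        exact ⟨⟨x, ha (by rw [hx', map_zero])⟩, rfl⟩
      · rintro ⟨x', hx'⟩
        have := congrArg (fun z : LinearMap.ker h => z.1.2) hx'
        exact Subtype.ext this.symm
    · rintro ⟨z, hz⟩
      have hz' : g z = 0 := hz
      obtain ⟨x, hx⟩ := (hab (g' z)).1 (by rw [hbg, hz'])
      obtain ⟨x', rfl⟩ := hf x
      exact ⟨⟨(-x', z), by simp [h, hx]⟩, rfl⟩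
  refine ⟨r + s, h ∘ₗ e.toLinearMap, hh.comp e.surjective, ?_⟩
  refine key.of_equiv (LinearEquiv.ofSubmodules e.symm _ _ ?_)
  ext x
  simp [Submodule.mem_map_equiv]

lemma extensionProperty (n : ℕ) : ExtensionProperty R n := by
  induction n with
  | zero =>
    intro X Y Z _ _ _ _ _ _ a b ha hab hb hX hZ
    have : Subsingleton X := hX
    have : Subsingleton Z := hZ
    refine ⟨fun y y' => ?_⟩
    have h0 : ∀ y : Y, y = 0 := fun y => by
      obtain ⟨x, rfl⟩ := (hab y).1 (Subsingleton.elim _ _)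
      rw [Subsingleton.elim x 0, map_zero]
    rw [h0 y, h0 y']
  | succ n ih =>
    intro X Y Z _ _ _ _ _ _ a b ha hab hb hX hZ
    -- `HasFiniteFreeResAux R (n + 1)` unfolds to `HasFiniteFreeRes R n`.
    exact ih.extension a b ha hab hb hX hZ

/-- The cokernel of an injective homomorphism of modules with finite free resolutions. -/
lemma HasFiniteFreeRes.cokernel {n : ℕ} {X : Type v₁} {Y : Type v₂} {Z : Type v₃} [AddCommGroup X]
    [AddCommGroup Y] [AddCommGroup Z] [Module R X] [Module R Y] [Module R Z] (a : X →ₗ[R] Y)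
    (b : Y →ₗ[R] Z) (ha : Function.Injective a) (hab : Function.Exact a b)
    (hb : Function.Surjective b) (hX : HasFiniteFreeRes R n X) (hY : HasFiniteFreeRes R n Y) :
    HasFiniteFreeRes R (n + 1) Z := by
  obtain ⟨r, f, hf, hkf⟩ := hY
  refine ⟨r, b ∘ₗ f, hb.comp hf, ?_⟩
  have hba : ∀ x, b (a x) = 0 := fun x => (hab _).2 ⟨x, rfl⟩
  let ea := LinearEquiv.ofInjective a ha
  let i : LinearMap.ker f →ₗ[R] LinearMap.ker (b ∘ₗ f) :=
    Submodule.inclusion (LinearMap.ker_le_ker_comp f b)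
  let j : LinearMap.ker (b ∘ₗ f) →ₗ[R] LinearMap.range a :=
    f.restrict (fun x hx => (hab _).1 hx)
  -- The kernel of `b ∘ f` is an extension of `range a ≅ X` by `ker f`.
  refine (extensionProperty n).extension i (ea.symm.toLinearMap ∘ₗ j) ?_ ?_ ?_ hkf.succ hX
  · exact Submodule.inclusion_injective _
  · rintro ⟨x, hx⟩
    constructor
    · intro h
      have h1 : j ⟨x, hx⟩ = 0 := by simpa using h
      exact ⟨⟨x, congrArg Subtype.val h1⟩, rfl⟩
    · rintro ⟨⟨x', hx'⟩, h⟩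
      have : x' = x := congrArg Subtype.val h
      subst this
      have h1 : j ⟨x', hx⟩ = 0 := Subtype.ext hx'
      simp [h1]
  · refine ea.symm.surjective.comp ?_
    rintro ⟨_, x, rfl⟩
    obtain ⟨y, hy⟩ := hf (a x)
    exact ⟨⟨y, by simp [hy, hba]⟩, Subtype.ext hy⟩

/-- An explicit resolution of length at most `n` by free modules of finite rank. -/
def HasExplicitRes (R : Type w) [Ring R] (n : ℕ) (M : Type v) [AddCommGroup M] [Module R M] :
    Prop :=
  ∃ (r : ℕ → ℕ) (d : ∀ i, (Fin (r (i + 1)) → R) →ₗ[R] (Fin (r i) → R))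
    (ε : (Fin (r 0) → R) →ₗ[R] M),
    (∀ i, n < i → r i = 0) ∧ Function.Surjective ε ∧ Function.Exact (d 0) ε ∧
    ∀ i, Function.Exact (d (i + 1)) (d i)

/-- Splicing: the augmentation of the resolution of the kernel, followed by the inclusion, becomes
the differential in degree 0. -/
lemma HasExplicitRes.of_ker {n r : ℕ} {M : Type v} [AddCommGroup M] [Module R M]
    (f : (Fin r → R) →ₗ[R] M) (hf : Function.Surjective f)
    (h : HasExplicitRes R n (LinearMap.ker f)) : HasExplicitRes R (n + 1) M := by
  obtain ⟨s, d, ε, hs, hε, h0, hd⟩ := h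
  have hrange : ∀ x, f x = 0 ↔ x ∈ Set.range ((LinearMap.ker f).subtype ∘ₗ ε) := fun x =>
    ⟨fun hx => by
      obtain ⟨y, hy⟩ := hε ⟨x, hx⟩
      exact ⟨y, congrArg Subtype.val hy⟩, by rintro ⟨y, rfl⟩; exact (ε y).2⟩
  refine ⟨fun i => Nat.casesOn i r s, fun i => match i with
    | 0 => (LinearMap.ker f).subtype ∘ₗ ε
    | i + 1 => d i, f, ?_, hf, hrange, ?_⟩
  · rintro (_ | i) hi
    · omega
    · exact hs i (by omega)
  · rintro (_ | i)
    · intro x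
      refine Iff.trans ?_ (h0 x)
      change ((ε x : LinearMap.ker f) : Fin r → R) = 0 ↔ _
      simp
    · exact hd i

lemma HasFiniteFreeResAux.hasExplicitRes : ∀ {n : ℕ} {M : Type w} [AddCommGroup M] [Module R M],
    HasFiniteFreeResAux R n M → HasExplicitRes R n M
  | 0, M, _, _, h => by
    have : Subsingleton M := h
    refine ⟨fun _ => 0, fun _ => 0, 0, fun _ _ => rfl, fun x => ⟨0, Subsingleton.elim _ _⟩, ?_, ?_⟩
    · exact fun x => ⟨fun _ => ⟨0, Subsingleton.elim _ _⟩, fun _ => Subsingleton.elim _ _⟩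
    · exact fun i x => ⟨fun _ => ⟨0, Subsingleton.elim _ _⟩, fun _ => rfl⟩
  | n + 1, M, _, _, ⟨r, f, hf, h⟩ => .of_ker f hf h.hasExplicitRes

lemma HasFiniteFreeRes.hasExplicitRes {n : ℕ} {M : Type v} [AddCommGroup M] [Module R M]
    (h : HasFiniteFreeRes R n M) : HasExplicitRes R (n + 1) M := by
  obtain ⟨r, f, hf, h⟩ := h
  exact .of_ker f hf h.hasExplicitRes

end FiniteFreeResolution

end Plectic

namespace Plectic

/-! ### Permutation modules -/

section PermutationModules

open Finsupp

variable (G : Type*) [Group G]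

/-- The representation on the free abelian group over a `G`-set. -/
noncomputable def permRep (Y : Type*) [MulAction G Y] : Representation ℤ G (Y →₀ ℤ) where
  toFun g := lmapDomain ℤ ℤ (g • ·)
  map_one' := by ext; simp
  map_mul' g h := by ext; simp [mul_smul]

/-- The free abelian group over a `G`-set, as a module over the group ring. -/
abbrev PermModule (Y : Type*) [MulAction G Y] : Type _ := (permRep G Y).asModule

variable {G} {Y Z : Type*} [MulAction G Y] [MulAction G Z]

@[simp] lemma permRep_single (g : G) (y : Y) (n : ℤ) :
    permRep G Y g (single y n) = single (g • y) n := by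
  simp [permRep]

/-- The homomorphism of modules over the group ring given by an equivariant linear map. -/
noncomputable def permHom (f : (Y →₀ ℤ) →ₗ[ℤ] (Z →₀ ℤ))
    (hf : ∀ g : G, f ∘ₗ permRep G Y g = permRep G Z g ∘ₗ f) :
    PermModule G Y →ₗ[MonoidAlgebra ℤ G] PermModule G Z :=
  { toFun := fun v => (permRep G Z).asModuleEquiv.symm (f ((permRep G Y).asModuleEquiv v))
    map_add' := fun v w => by simp only [map_add]
    map_smul' := fun c v => by
      rw [LinearEquiv.symm_apply_eq, RingHom.id_apply, Representation.asModuleEquiv_map_smul,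
        Representation.asModuleEquiv_map_smul, LinearEquiv.apply_symm_apply]
      induction c using MonoidAlgebra.induction_linear with
      | zero => simp
      | add a b ha hb => simp only [map_add, LinearMap.add_apply, ha, hb]
      | single g n =>
        simp only [Representation.asAlgebraHom_single, LinearMap.smul_apply, map_smul]
        exact congrArg (n • ·) (LinearMap.congr_fun (hf g) _) }

lemma smul_single_eq_mapDomain (a : MonoidAlgebra ℤ G) (y : Y) :
    (permRep G Y).asModuleEquiv (a • (permRep G Y).asModuleEquiv.symm (single y 1)) =
      mapDomain (fun g => g • y) a.coeff := by
  induction a using MonoidAlgebra.induction_linear with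
  | zero => simp
  | add a b ha hb =>
    rw [add_smul, map_add, ha, hb, MonoidAlgebra.coeff_add, mapDomain_add]
  | single g n =>
    rw [Representation.asModuleEquiv_map_smul, Representation.asAlgebraHom_single,
      LinearEquiv.apply_symm_apply, LinearMap.smul_apply, permRep_single,
      MonoidAlgebra.coeff_single, mapDomain_single, smul_single_one]

/-- A `G`-set with free action and finitely many orbits gives a free module of finite rank. -/
lemma hasFiniteFreeRes_permModule_of_free (hfree : ∀ (g : G) (y : Y), g • y = y → g = 1)
    (K : Set Y) (hK : K.Finite) (hcov : ∀ y : Y, ∃ g : G, g • y ∈ K) :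
    HasFiniteFreeRes (MonoidAlgebra ℤ G) 0 (PermModule G Y) := by
  classical
  let Ω := MulAction.orbitRel.Quotient G Y
  have hΩ : Finite Ω := by
    have := hK.to_subtype
    refine Finite.of_surjective (fun k : K => (Quotient.mk'' k.1 : Ω)) fun ω => ?_
    induction ω using Quotient.inductionOn' with | h y =>
    obtain ⟨g, hg⟩ := hcov y
    exact ⟨⟨_, hg⟩, Quotient.sound' ⟨g, rfl⟩⟩
  obtain ⟨r, ⟨e⟩⟩ := Finite.exists_equiv_fin Ω
  let y : Fin r → Y := fun j => (e.symm j).out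
  have hy : ∀ (j k : Fin r) (g h : G), g • y j = h • y k → j = k ∧ g = h := by
    intro j k g h hgh
    have hjk : j = k := by
      apply e.symm.injective
      rw [← Quotient.out_eq' (e.symm j), ← Quotient.out_eq' (e.symm k)]
      refine Quotient.sound' ⟨g⁻¹ * h, ?_⟩
      change (g⁻¹ * h) • y k = y j
      rw [mul_smul, ← hgh, inv_smul_smul]
    subst hjk
    refine ⟨rfl, ?_⟩
    have := hfree (h⁻¹ * g) (y j) (by rw [mul_smul, hgh, inv_smul_smul])
    exact (inv_mul_eq_one.1 this).symm
  have hsurj : ∀ z : Y, ∃ (j : Fin r) (g : G), z = g • y j := by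
    intro z
    have : MulAction.orbitRel G Y z (y (e (Quotient.mk'' z))) := by
      apply Quotient.exact'
      simp only [y, Equiv.symm_apply_apply]
      exact (Quotient.out_eq' _).symm
    obtain ⟨g, hg⟩ := this
    exact ⟨_, g, hg.symm⟩
  let E := (permRep G Y).asModuleEquiv
  let f : (Fin r → MonoidAlgebra ℤ G) →ₗ[MonoidAlgebra ℤ G] PermModule G Y :=
    Fintype.linearCombination _ (fun j => E.symm (single (y j) 1))
  have hf : ∀ v, E (f v) = ∑ j, mapDomain (fun g => g • y j) (v j).coeff := by
    intro v
    simp only [f, Fintype.linearCombination_apply, map_sum]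
    exact Finset.sum_congr rfl fun j _ => smul_single_eq_mapDomain _ _
  -- By freeness each point is `g • y j` for only one pair `(j, g)`, so the coefficients of `v` can
  -- be read off from `f v`; this gives injectivity.
  have hcoeff : ∀ v j g, E (f v) (g • y j) = (v j).coeff g := by
    intro v j g
    rw [hf, finsetSum_apply, Finset.sum_eq_single j]
    · rw [mapDomain_apply]
      exact fun a b hab => (hy j j a b hab).2
    · intro k _ hkj
      rw [mapDomain_of_notMem_range]
      rintro ⟨h, hh⟩
      exact hkj (hy k j h g hh).1
    · simp
  refine ⟨r, f, ?_, ?_⟩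
  · rw [← LinearMap.range_eq_top, eq_top_iff]
    rintro x -
    obtain ⟨x, rfl⟩ := E.symm.surjective x
    induction x using Finsupp.induction_linear with
    | zero => simp
    | add a b ha hb => rw [map_add]; exact add_mem ha hb
    | single z n =>
      obtain ⟨j, g, rfl⟩ := hsurj z
      refine ⟨Pi.single j (MonoidAlgebra.single g n), ?_⟩
      apply E.injective
      rw [hf, Finset.sum_eq_single j]
      · simp [mapDomain_single]
      · intro k _ hk
        simp [hk]
      · simp
  · refine ⟨fun v w => ?_⟩
    have h0 : ∀ v : LinearMap.ker f, v = 0 := by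
      rintro ⟨v, hv⟩
      have hv' : f v = 0 := hv
      ext j g
      have := hcoeff v j g
      rw [hv'] at this
      simpa using this.symm
    rw [h0 v, h0 w]

end PermutationModules

/-! ### One-dimensional cell complexes -/

section CellComplex

open Finsupp

/-- The boundary map of a one-dimensional complex with cells `A` and `B`, where `b : B` has the
boundary `t b - s b`. -/
noncomputable def boundary {A B : Type*} (s t : B → A) : (B →₀ ℤ) →ₗ[ℤ] (A →₀ ℤ) :=
  lmapDomain ℤ ℤ t - lmapDomain ℤ ℤ s

@[simp] lemma boundary_single {A B : Type*} (s t : B → A) (b : B) (n : ℤ) :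
    boundary s t (single b n) = single (t b) n - single (s b) n := by
  simp [boundary]

/-- The augmented chain complex `0 → ℤ[B] → ℤ[A] → ℤ → 0` is exact. -/
structure IsAcyclicComplex {A B : Type*} (s t : B → A) : Prop where
  injective : Function.Injective (boundary s t)
  connected : ∀ a a', single a 1 - single a' 1 ∈ LinearMap.range (boundary s t)

variable {G : Type*} [Group G] {A B : Type*} [MulAction G A] [MulAction G B] {s t : B → A}
  (hs : ∀ (g : G) b, s (g • b) = g • s b) (ht : ∀ (g : G) b, t (g • b) = g • t b)
  {Y : Type*} [MulAction G Y]

lemma lcomapDomain_prodMk_single [DecidableEq Y] {X : Type*} (y z : Y) (x : X) (n : ℤ) :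
    lcomapDomain (R := ℤ) (Prod.mk y) (Prod.mk_right_injective y) (single (z, x) n) =
      if z = y then single x n else 0 := by
  classical
  ext x'
  change single (z, x) n (y, x') = _
  split_ifs with hz
  · subst hz
    simp [single_apply]
  · simp [hz]

lemma lmapDomain_single {X X' : Type*} (f : X → X') (x : X) (n : ℤ) :
    lmapDomain ℤ ℤ f (single x n) = single (f x) n := by simp

/-- Restriction to a slice `{y} × B` or `{y} × A` commutes with the boundary, so injectivity is
checked slice by slice. -/
lemma IsAcyclicComplex.injective_prod (h : IsAcyclicComplex s t) :
    Function.Injective (boundary (Prod.map (id : Y → Y) s) (Prod.map (id : Y → Y) t)) := by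
  rw [← LinearMap.ker_eq_bot, LinearMap.ker_eq_bot']
  intro f hf
  have key : ∀ y : Y, boundary s t ∘ₗ lcomapDomain (Prod.mk y) (Prod.mk_right_injective y) =
      lcomapDomain (Prod.mk y) (Prod.mk_right_injective y) ∘ₗ
        boundary (Prod.map (id : Y → Y) s) (Prod.map (id : Y → Y) t) := by
    classical
    intro y
    refine Finsupp.lhom_ext fun ⟨z, b⟩ n => ?_
    simp only [LinearMap.comp_apply, boundary_single, Prod.map, id, map_sub,
      lcomapDomain_prodMk_single]
    split_ifs <;> simp
  ext ⟨y, b⟩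
  have h1 := LinearMap.congr_fun (key y) f
  simp only [LinearMap.comp_apply, hf, map_zero] at h1
  have h2 := h.injective (h1.trans (map_zero _).symm)
  exact DFunLike.congr_fun h2 b

/-- Modulo boundaries every chain can be pushed, within its slices, to the base point `a₀`; what
remains is determined by its projection to `Y`. -/
lemma IsAcyclicComplex.exact_prod [Nonempty A] (h : IsAcyclicComplex s t) :
    Function.Exact (boundary (Prod.map (id : Y → Y) s) (Prod.map (id : Y → Y) t))
      (lmapDomain ℤ ℤ (Prod.fst : Y × A → Y)) := by
  obtain ⟨a₀⟩ := ‹Nonempty A›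
  intro f
  constructor
  · intro hf
    have key : ∀ f : Y × A →₀ ℤ, f - lmapDomain ℤ ℤ (fun y => (y, a₀))
        (lmapDomain ℤ ℤ (Prod.fst : Y × A → Y) f) ∈
        LinearMap.range (boundary (Prod.map (id : Y → Y) s) (Prod.map (id : Y → Y) t)) := by
      intro f
      induction f using Finsupp.induction_linear with
      | zero => simp
      | add a b ha hb =>
        rw [map_add, map_add, add_sub_add_comm]
        exact add_mem ha hb
      | single z n =>
        obtain ⟨y, a⟩ := z
        obtain ⟨c, hc⟩ := h.connected a a₀
        refine ⟨n • lmapDomain ℤ ℤ (Prod.mk y) c, ?_⟩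
        have comm : boundary (Prod.map (id : Y → Y) s) (Prod.map (id : Y → Y) t) ∘ₗ
            lmapDomain ℤ ℤ (Prod.mk y) = lmapDomain ℤ ℤ (Prod.mk y) ∘ₗ boundary s t :=
          Finsupp.lhom_ext fun b n => by
            simp [-lmapDomain_apply, lmapDomain_single]
        have := LinearMap.congr_fun comm c
        simp only [LinearMap.comp_apply, hc] at this
        rw [map_smul, this]
        simp [-lmapDomain_apply, lmapDomain_single, smul_sub]
    have := key f
    rwa [hf, map_zero, sub_zero] at this
  · rintro ⟨c, rfl⟩
    have : lmapDomain ℤ ℤ (Prod.fst : Y × A → Y) ∘ₗ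
        boundary (Prod.map (id : Y → Y) s) (Prod.map (id : Y → Y) t) = 0 :=
      Finsupp.lhom_ext fun b n => by simp [-lmapDomain_apply, lmapDomain_single]
    exact LinearMap.congr_fun this c

include hs ht in
/-- If the permutation modules of `Y × A` and `Y × B` have finite free resolutions, then so does
that of `Y`, where `A` and `B` are the cells of an acyclic complex. -/
lemma IsAcyclicComplex.hasFiniteFreeRes [Nonempty A] (h : IsAcyclicComplex s t) {n : ℕ}
    (hA : HasFiniteFreeRes (MonoidAlgebra ℤ G) n (PermModule G (Y × A)))
    (hB : HasFiniteFreeRes (MonoidAlgebra ℤ G) n (PermModule G (Y × B))) :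
    HasFiniteFreeRes (MonoidAlgebra ℤ G) (n + 1) (PermModule G Y) := by
  refine HasFiniteFreeRes.cokernel
    (permHom (boundary (Prod.map (id : Y → Y) s) (Prod.map (id : Y → Y) t)) fun g => ?_)
    (permHom (lmapDomain ℤ ℤ (Prod.fst : Y × A → Y)) fun g => ?_) ?_ ?_ ?_ hB hA
  · exact Finsupp.lhom_ext fun b n => by simp [hs, ht, Prod.map, Prod.smul_def]
  · exact Finsupp.lhom_ext fun b n => by simp
  · exact fun x y hxy => h.injective_prod hxy
  · exact fun x => h.exact_prod x
  · obtain ⟨a₀⟩ := ‹Nonempty A›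
    exact fun x => mapDomain_surjective (M := ℤ) (f := (Prod.fst : Y × A → Y))
      (fun y => ⟨(y, a₀), rfl⟩) x

end CellComplex

end Plectic

namespace Plectic

/-! ### Finite free resolutions from products of acyclic complexes -/

section CellProducts

universe u w

variable {G : Type w} [Group G] {I : Type*} (A B : I → Type u) [∀ i, MulAction G (A i)]
  [∀ i, MulAction G (B i)] (s t : ∀ i, B i → A i)

/-- Let `G` act on the acyclic one-dimensional complexes with cells `A i` and `B i`. If `G` acts
freely and with finitely many orbits on the cells of the product of `Y` and all these complexes,
then the permutation module of `Y` has a finite free resolution. -/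
theorem exists_hasFiniteFreeRes_permModule
    (hs : ∀ i (g : G) b, s i (g • b) = g • s i b) (ht : ∀ i (g : G) b, t i (g • b) = g • t i b)
    (hacyc : ∀ i, IsAcyclicComplex (s i) (t i)) (hne : ∀ i, Nonempty (A i))
    (hfib : ∀ i a, (t i ⁻¹' {a}).Finite) (J : Finset I) :
    ∀ (Y : Type u) [MulAction G Y],
      (∀ g : G, (∃ y : Y, g • y = y) → (∀ i ∈ J, ∃ a : A i, g • a = a) → g = 1) →
      (∃ (K : Set Y) (D : ∀ i, Set (A i)), K.Finite ∧ (∀ i, (D i).Finite) ∧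
        ∀ (y : Y) (x : ∀ i, A i), ∃ g : G, g • y ∈ K ∧ ∀ i ∈ J, g • x i ∈ D i) →
      ∃ n, HasFiniteFreeRes (MonoidAlgebra ℤ G) n (PermModule G Y) := by
  classical
  -- `Y` stays general because it absorbs the cells of the factors already removed: the factor `j`
  -- replaces `Y` by `Y × A j` and by `Y × B j`.
  induction J using Finset.induction_on with
  | empty =>
    rintro Y _ hfree ⟨K, D, hK, -, hcov⟩
    refine ⟨0, hasFiniteFreeRes_permModule_of_free (fun g y hgy => hfree g ⟨y, hgy⟩ (by simp)) K hK
      fun y => ?_⟩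
    obtain ⟨g, hg, -⟩ := hcov y (fun i => (hne i).some)
    exact ⟨g, hg⟩
  | insert j J hj ih =>
    rintro Y _ hfree ⟨K, D, hK, hD, hcov⟩
    have hcov' : ∀ (y : Y) (a : A j) (x : ∀ i, A i), ∃ g : G, g • y ∈ K ∧ g • a ∈ D j ∧
        ∀ i ∈ J, g • x i ∈ D i := by
      intro y a x
      obtain ⟨g, hg, hx⟩ := hcov y (Function.update x j a)
      refine ⟨g, hg, by simpa using hx j (Finset.mem_insert_self _ _), fun i hi => ?_⟩
      have hij : i ≠ j := fun h => hj (h ▸ hi)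
      simpa [hij] using hx i (Finset.mem_insert_of_mem hi)
    obtain ⟨m, hm⟩ := ih (Y × A j)
      (by
        rintro g ⟨⟨y, a⟩, hya⟩ hJ
        rw [Prod.smul_mk, Prod.mk.injEq] at hya
        refine hfree g ⟨y, hya.1⟩ fun i hi => ?_
        obtain rfl | hi := Finset.mem_insert.1 hi
        exacts [⟨a, hya.2⟩, hJ i hi])
      ⟨K ×ˢ D j, D, hK.prod (hD j), hD, fun ⟨y, a⟩ x => by
        obtain ⟨g, h1, h2, h3⟩ := hcov' y a x
        exact ⟨g, ⟨h1, h2⟩, h3⟩⟩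
    obtain ⟨n, hn⟩ := ih (Y × B j)
      (by
        rintro g ⟨⟨y, b⟩, hyb⟩ hJ
        rw [Prod.smul_mk, Prod.mk.injEq] at hyb
        refine hfree g ⟨y, hyb.1⟩ fun i hi => ?_
        obtain rfl | hi := Finset.mem_insert.1 hi
        exacts [⟨t _ b, by rw [← ht, hyb.2]⟩, hJ i hi])
      -- A 1-cell is moved by moving its endpoint `t j b` into `D j`; finite fibres of `t j` keep
      -- the fundamental set finite.
      ⟨K ×ˢ (t j ⁻¹' D j), D, hK.prod ((hD j).preimage' fun a _ => hfib j a), hD,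
        fun ⟨y, b⟩ x => by
        obtain ⟨g, h1, h2, h3⟩ := hcov' y (t j b) x
        refine ⟨g, ⟨h1, ?_⟩, h3⟩
        change t j (g • b) ∈ D j
        rwa [ht]⟩
    have := hne j
    exact ⟨_, (hacyc j).hasFiniteFreeRes (hs j) (ht j) (hm.mono (le_max_left m n))
      (hn.mono (le_max_right m n))⟩

end CellProducts

/-! ### Automorphisms of prime order -/

section PrimeOrder

open Finsupp

variable {X : Type*} {ℓ : ℕ} (hℓ : ℓ.Prime) (σ : Equiv.Perm X) (hσ : σ ^ ℓ = 1)
  (hfix : ∀ x, σ x ≠ x)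

include hℓ hσ hfix

/-- Each level set of `z` in its support is finite and is permuted by `σ` without fixed points, so
its cardinality is divisible by `ℓ`. -/
lemma prime_dvd_sum_of_invariant (z : X →₀ ℤ) (hz : mapDomain σ z = z) :
    (ℓ : ℤ) ∣ z.sum fun _ n => n := by
  classical
  have := Fact.mk hℓ
  have hzx : ∀ x, z (σ x) = z x := fun x => by
    conv_lhs => rw [← hz]
    exact mapDomain_apply σ.injective _ _
  have h1 : z.sum (fun _ n => n) = ∑ b ∈ z.support.image z,
      (z.support.filter fun a => z a = b).card • b := by
    rw [Finsupp.sum]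
    exact Finset.sum_comp id z
  rw [h1]
  refine Finset.dvd_sum fun b _ => ?_
  rw [nsmul_eq_mul]
  refine Dvd.dvd.mul_right (Int.natCast_dvd_natCast.2 ?_) _
  set T := z.support.filter fun a => z a = b
  have hT : ∀ x, x ∈ T ↔ σ x ∈ T := fun x => by simp [T, hzx]
  let τ : Equiv.Perm T := σ.subtypePerm fun x => (hT x).symm
  have hτ : τ ^ ℓ ^ 1 = 1 := by
    rw [pow_one, Equiv.Perm.subtypePerm_pow]
    ext x
    simp [hσ]
  have hmod := Equiv.Perm.card_compl_support_modEq hτ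
  have h0 : τ.supportᶜ = ∅ := by
    rw [Finset.compl_eq_empty_iff, Finset.eq_univ_iff_forall]
    exact fun x => Equiv.Perm.mem_support.2 fun h => hfix x.1 (congrArg Subtype.val h)
  rw [h0, Finset.card_empty, Fintype.card_coe] at hmod
  exact (Nat.modEq_zero_iff_dvd).1 hmod.symm

lemma pow_apply_ne {i : ℕ} (h0 : i ≠ 0) (hi : i < ℓ) (x : X) : (σ ^ i) x ≠ x := by
  intro h
  have h1 : Function.IsPeriodicPt σ i x := by
    rw [Function.IsPeriodicPt, Function.IsFixedPt, ← Equiv.Perm.coe_pow, h]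
  have h2 : Function.IsPeriodicPt σ ℓ x := by
    rw [Function.IsPeriodicPt, Function.IsFixedPt, ← Equiv.Perm.coe_pow, hσ, Equiv.Perm.one_apply]
  have h3 := h1.gcd h2
  rw [(Nat.coprime_of_lt_prime h0 hi hℓ).symm.gcd_eq_one] at h3
  exact hfix x h3

/-- All orbits being regular, `ℤ[X]` is free over the group ring of the cyclic group of order `ℓ`,
and there the kernel of the norm is the image of `σ - 1`. -/
lemma exists_eq_sub_of_norm_eq_zero (f : X →₀ ℤ)
    (hf : ∑ i ∈ Finset.range ℓ, mapDomain ⇑(σ ^ i) f = 0) :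
    ∃ f' : X →₀ ℤ, f = mapDomain σ f' - f' := by
  classical
  let r : X → X := fun x => (Quotient.mk (Equiv.Perm.SameCycle.setoid σ) x).out
  have hr : ∀ x y, σ.SameCycle x y → r x = r y := fun x y h =>
    congrArg Quotient.out (Quotient.sound h)
  have hrx : ∀ x, σ.SameCycle (r x) x := fun x => Quotient.mk_out (s := Equiv.Perm.SameCycle.setoid σ) x
  have hk : ∀ x, ∃ k : ℕ, (σ ^ k) (r x) = x := by
    intro x
    obtain ⟨i, hi⟩ := hrx x
    refine ⟨(i % ℓ).toNat, ?_⟩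
    have hpos : 0 ≤ i % (ℓ : ℤ) := Int.emod_nonneg _ (by exact_mod_cast hℓ.ne_zero)
    rw [← zpow_natCast, Int.toNat_of_nonneg hpos]
    conv_rhs => rw [← hi, ← Int.mul_ediv_add_emod i ℓ, zpow_add, zpow_mul, zpow_natCast, hσ,
      one_zpow, one_mul]
  choose k hk using hk
  let h : (X →₀ ℤ) →ₗ[ℤ] (X →₀ ℤ) :=
    Finsupp.linearCombination ℤ fun x => ∑ i ∈ Finset.range (k x), single ((σ ^ i) (r x)) (1 : ℤ)
  -- `h` sums along the path from the representative `r x` to `x`, so `(σ - 1) h` telescopes to `1 -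
  -- r`. It remains to show that `r` kills `f`.
  have hh : ∀ f, lmapDomain ℤ ℤ σ (h f) - h f = f - lmapDomain ℤ ℤ r f := by
    intro f
    induction f using Finsupp.induction_linear with
    | zero => simp
    | add a b ha hb =>
      simp only [map_add]
      rw [add_sub_add_comm, ha, hb, add_sub_add_comm]
    | single x n =>
      simp only [h, linearCombination_single, map_smul, map_sum, lmapDomain_single]
      rw [← smul_sub, ← Finset.sum_sub_distrib]
      have : ∀ i, single (σ ((σ ^ i) (r x))) (1 : ℤ) - single ((σ ^ i) (r x)) 1 =
          single ((σ ^ (i + 1)) (r x)) (1 : ℤ) - single ((σ ^ i) (r x)) 1 := fun i => by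
        rw [pow_succ', Equiv.Perm.mul_apply]
      simp only [this]
      rw [Finset.sum_range_sub fun i => single ((σ ^ i) (r x)) (1 : ℤ), hk]
      simp [smul_sub]
  let N : (X →₀ ℤ) →ₗ[ℤ] (X →₀ ℤ) := ∑ i ∈ Finset.range ℓ, lmapDomain ℤ ℤ ⇑(σ ^ i)
  have hN : N ∘ₗ lmapDomain ℤ ℤ σ = N := by
    refine Finsupp.lhom_ext fun x n => ?_
    simp only [N, LinearMap.comp_apply, LinearMap.sum_apply, lmapDomain_single]
    have : ∀ i, single ((σ ^ i) (σ x)) n = single ((σ ^ (i + 1)) x) n := fun i => by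
      rw [pow_succ, Equiv.Perm.mul_apply]
    simp only [this]
    have h1 := Finset.sum_range_succ (fun i => single ((σ ^ i) x) n) ℓ
    rw [Finset.sum_range_succ', hσ, pow_zero] at h1
    exact add_right_cancel h1
  let P : (X →₀ ℤ) →ₗ[ℤ] (X →₀ ℤ) :=
    Finsupp.linearCombination ℤ fun x => if r x = x then single x (1 : ℤ) else 0
  have hrr : ∀ x i, r ((σ ^ i) (r x)) = r x := fun x i =>
    hr _ _ ((Equiv.Perm.SameCycle.trans ⟨-i, by simp⟩ (hrx x)))
  -- `P` keeps only the coefficients at representatives; of the summands of the norm, only the one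
  -- for `i = 0` leaves a representative in place.
  have hP : P ∘ₗ N ∘ₗ lmapDomain ℤ ℤ r = lmapDomain ℤ ℤ r := by
    refine Finsupp.lhom_ext fun x n => ?_
    simp only [N, LinearMap.comp_apply, LinearMap.sum_apply, lmapDomain_single, map_sum]
    rw [Finset.sum_eq_single 0]
    · have := hrr x 0
      rw [pow_zero, Equiv.Perm.one_apply] at this
      simp [P, this]
    · intro i hi hi0
      have := pow_apply_ne hℓ σ hσ hfix hi0 (Finset.mem_range.1 hi) (r x)
      simp only [P, linearCombination_single, hrr, if_neg this.symm, smul_zero]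
    · intro h0
      exact absurd (Finset.mem_range.2 hℓ.pos) h0
  have hNf : N f = 0 := by simpa [N] using hf
  have hNr : N (lmapDomain ℤ ℤ r f) = 0 := by
    have := congrArg N (hh f)
    rw [map_sub, map_sub, hNf, ← LinearMap.comp_apply, hN, sub_self, zero_sub] at this
    exact neg_eq_zero.1 this.symm
  have hrf : lmapDomain ℤ ℤ r f = 0 := by
    rw [← hP, LinearMap.comp_apply, LinearMap.comp_apply, hNr, map_zero]
  refine ⟨h f, ?_⟩
  have := hh f
  rw [hrf, sub_zero] at this
  exact this.symm

end PrimeOrder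

/-! ### Fixed cells of automorphisms of prime order -/

section FixedCell

open Finsupp

variable {G : Type*} [Group G] {A B : Type*} [MulAction G A] [MulAction G B] {s t : B → A}

/-- If `g` fixes no 0-cell, it fixes no 1-cell either. A chain `f` with boundary `g a₀ - a₀` has
norm zero, because the norm of its boundary telescopes; hence `f = (g - 1) f'`. This yields an
invariant 0-chain of augmentation `-1`, which `ℓ` would have to divide. -/
lemma IsAcyclicComplex.exists_fixed [Nonempty A] (h : IsAcyclicComplex s t)
    (hs : ∀ (g : G) b, s (g • b) = g • s b) (ht : ∀ (g : G) b, t (g • b) = g • t b)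
    {ℓ : ℕ} (hℓ : ℓ.Prime) (g : G) (hg : g ^ ℓ = 1) : ∃ a : A, g • a = a := by
  by_contra! hno
  obtain ⟨a₀⟩ := ‹Nonempty A›
  let σ : Equiv.Perm A := MulAction.toPerm g
  let τ : Equiv.Perm B := MulAction.toPerm g
  have hσi : ∀ i, σ ^ i = MulAction.toPerm (g ^ i) := fun i =>
    ((MulAction.toPermHom G A).map_pow g i).symm
  have hτi : ∀ i, τ ^ i = MulAction.toPerm (g ^ i) := fun i =>
    ((MulAction.toPermHom G B).map_pow g i).symm
  have hσ : σ ^ ℓ = 1 := by rw [hσi, hg]; ext; simp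
  have hτ : τ ^ ℓ = 1 := by rw [hτi, hg]; ext; simp
  have hnoB : ∀ b, τ b ≠ b := fun b hb => hno (s b) (by rw [← hs]; exact congrArg s hb)
  have hcomm : ∀ i : ℕ, boundary s t ∘ₗ lmapDomain ℤ ℤ ⇑(τ ^ i) =
      lmapDomain ℤ ℤ ⇑(σ ^ i) ∘ₗ boundary s t := fun i =>
    Finsupp.lhom_ext fun b n => by
      simp [-lmapDomain_apply, lmapDomain_single, hσi, hτi, hs, ht]
  obtain ⟨f, hf⟩ := h.connected (g • a₀) a₀
  have hNf : ∑ i ∈ Finset.range ℓ, mapDomain ⇑(τ ^ i) f = 0 := by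
    apply h.injective
    rw [map_sum, map_zero]
    have : ∀ i : ℕ, boundary s t (mapDomain ⇑(τ ^ i) f) =
        single (g ^ (i + 1) • a₀) 1 - single (g ^ i • a₀) 1 := fun i => by
      have := LinearMap.congr_fun (hcomm i) f
      simp only [LinearMap.comp_apply, hf, map_sub, lmapDomain_single, hσi] at this
      rw [pow_succ, mul_smul]
      exact this
    simp only [this]
    rw [Finset.sum_range_sub fun i => single (g ^ i • a₀) (1 : ℤ), hg]
    simp
  obtain ⟨f', hf'⟩ := exists_eq_sub_of_norm_eq_zero hℓ τ hτ hnoB f hNf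
  have hz : mapDomain σ (boundary s t f' - single a₀ 1) = boundary s t f' - single a₀ 1 := by
    have h1 := LinearMap.congr_fun (hcomm 1) f'
    simp only [pow_one, LinearMap.comp_apply] at h1
    change lmapDomain ℤ ℤ σ _ = _
    rw [map_sub, ← h1, lmapDomain_single]
    have h2 : boundary s t (lmapDomain ℤ ℤ τ f') - boundary s t f' =
        single (g • a₀) 1 - single a₀ 1 := by
      rw [← hf, ← map_sub, hf']
      rfl
    have h3 : σ a₀ = g • a₀ := rfl
    rw [h3, sub_eq_sub_iff_sub_eq_sub, h2]
  have hdvd := prime_dvd_sum_of_invariant hℓ σ hσ hno _ hz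
  let ε : (A →₀ ℤ) →ₗ[ℤ] ℤ := Finsupp.linearCombination ℤ fun _ => (1 : ℤ)
  have hε : ∀ z : A →₀ ℤ, ε z = z.sum fun _ n => n := fun z => by
    simp [ε, Finsupp.linearCombination_apply]
  have hε0 : ε ∘ₗ boundary s t = 0 := Finsupp.lhom_ext fun b n => by simp [ε]
  rw [← hε, map_sub, ← LinearMap.comp_apply, hε0] at hdvd
  simp only [ε, linearCombination_single, LinearMap.zero_apply, zero_sub, smul_eq_mul, mul_one] at hdvd
  rw [dvd_neg] at hdvd
  have := Int.natCast_dvd_natCast.1 (by exact_mod_cast hdvd : ((ℓ : ℕ) : ℤ) ∣ ((1 : ℕ) : ℤ))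
  exact hℓ.one_lt.ne' (Nat.dvd_one.1 this)

end FixedCell

end Plectic

namespace Plectic

/-! ### Trees given by a parent map -/

section ParentMap

open Finsupp

variable {V : Type*}

/-- The vertices and edges, given by their sets of vertices, of a graph on the set `X`. -/
def simplices (T : SimpleGraph V) (X : Set V) : Set (Set V) :=
  {s | s ⊆ X ∧ ((∃ x, s = {x}) ∨ ∃ x y, T.Adj x y ∧ s = {x, y})}

/-- `p` sends each vertex of the tree `T` to the next vertex in the direction of some end, and the
subtree `X` contains the rays to that end. -/
structure IsParentMap (T : SimpleGraph V) (X : Set V) (p : V → V) : Prop where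
  mapsTo : ∀ x ∈ X, p x ∈ X
  aperiodic : ∀ n x, p^[n + 1] x ≠ x
  directed : ∀ x y, ∃ m n, p^[m] x = p^[n] y
  adj : ∀ x y, T.Adj x y ↔ y = p x ∨ x = p y

/-- Pairs of a vertex and an edge that contains it. -/
abbrev Flag (T : SimpleGraph V) (X : Set V) : Type _ :=
  {f : Set V × Set V // f.1 ∈ simplices T X ∧ f.2 ∈ simplices T X ∧ f.1 ⊂ f.2}

/-- The vertex of a flag. -/
def Flag.vertex {T : SimpleGraph V} {X : Set V} (f : Flag T X) : simplices T X := ⟨f.1.1, f.2.1⟩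

/-- The edge of a flag. -/
def Flag.edge {T : SimpleGraph V} {X : Set V} (f : Flag T X) : simplices T X := ⟨f.1.2, f.2.2.1⟩

variable {T : SimpleGraph V} {X : Set V} {p : V → V}

lemma finite_of_mem_simplices {s : Set V} (hs : s ∈ simplices T X) : s.Finite := by
  obtain ⟨-, ⟨x, rfl⟩ | ⟨x, y, -, rfl⟩⟩ := hs <;> simp

lemma nonempty_of_mem_simplices {s : Set V} (hs : s ∈ simplices T X) : s.Nonempty := by
  obtain ⟨-, ⟨x, rfl⟩ | ⟨x, y, -, rfl⟩⟩ := hs <;> simp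

lemma singleton_mem_simplices {x : V} (hx : x ∈ X) : {x} ∈ simplices T X :=
  ⟨by simpa using hx, Or.inl ⟨x, rfl⟩⟩

/-- This is the finiteness of the fibres of `t` when the target of a flag is its edge; no local
finiteness of the graph is needed. -/
lemma Flag.finite_edge_preimage (s : simplices T X) :
    (Flag.edge ⁻¹' {s} : Set (Flag T X)).Finite := by
  refine Set.Finite.of_injOn (f := fun f : Flag T X => f.1.1) (t := 𝒫 s.1) ?_ ?_
    (finite_of_mem_simplices s.2).finite_subsets
  · rintro f hf
    have : f.1.2 = s.1 := congrArg Subtype.val hf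
    rw [← this]
    exact f.2.2.2.subset
  · intro f hf g hg hfg
    have h1 : f.1.2 = s.1 := congrArg Subtype.val hf
    have h2 : g.1.2 = s.1 := congrArg Subtype.val hg
    exact Subtype.ext (Prod.ext hfg (h1.trans h2.symm))

/-- The descendants of a vertex. -/
def descendants (p : V → V) (x : V) : Set V := {y | ∃ n, p^[n] y = x}

lemma mem_descendants_of_apply {x y : V} (h : p y ∈ descendants p x) : y ∈ descendants p x := by
  obtain ⟨n, hn⟩ := h
  exact ⟨n + 1, hn⟩

namespace IsParentMap

variable (hp : IsParentMap T X p)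
include hp

lemma ne_self (x : V) : p x ≠ x := hp.aperiodic 0 x

lemma mem_simplices_iff {s : Set V} :
    s ∈ simplices T X ↔ ∃ x ∈ X, s = {x} ∨ s = {x, p x} := by
  constructor
  · rintro ⟨hsX, ⟨x, rfl⟩ | ⟨x, y, hxy, rfl⟩⟩
    · exact ⟨x, by simpa using hsX, Or.inl rfl⟩
    · rw [Set.insert_subset_iff, Set.singleton_subset_iff] at hsX
      obtain rfl | rfl := (hp.adj x y).1 hxy
      · exact ⟨x, hsX.1, Or.inr rfl⟩
      · exact ⟨y, hsX.2, Or.inr (Set.pair_comm _ _)⟩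
  · rintro ⟨x, hx, rfl | rfl⟩
    · exact singleton_mem_simplices hx
    · refine ⟨?_, Or.inr ⟨x, p x, (hp.adj _ _).2 (Or.inl rfl), rfl⟩⟩
      rw [Set.insert_subset_iff, Set.singleton_subset_iff]
      exact ⟨hx, hp.mapsTo x hx⟩

lemma pair_mem_simplices {x : V} (hx : x ∈ X) : {x, p x} ∈ simplices T X :=
  hp.mem_simplices_iff.2 ⟨x, hx, Or.inr rfl⟩

lemma exists_of_flag (f : Flag T X) :
    ∃ x ∈ X, f.1.2 = {x, p x} ∧ (f.1.1 = {x} ∨ f.1.1 = {p x}) := by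
  obtain ⟨⟨s, t⟩, hs, ht, hst⟩ := f
  obtain ⟨x, hx, rfl | rfl⟩ := hp.mem_simplices_iff.1 ht
  · exact absurd (Set.ssubset_singleton_iff.1 hst) (nonempty_of_mem_simplices hs).ne_empty
  · refine ⟨x, hx, rfl, ?_⟩
    have h1 := hst.subset
    rw [Set.subset_pair_iff_eq] at h1
    rcases h1 with h | h | h | h
    · exact absurd h (nonempty_of_mem_simplices hs).ne_empty
    · exact Or.inl h
    · exact Or.inr h
    · exact absurd h hst.ne

/-- Otherwise `x` and `y` would be parents of each other, a cycle of length 2 of `p`. -/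
lemma eq_of_pair_eq {x y : V} (h : ({x, p x} : Set V) = {y, p y}) : x = y := by
  have h1 : x ∈ ({y, p y} : Set V) := h ▸ Set.mem_insert _ _
  have h2 : y ∈ ({x, p x} : Set V) := h ▸ Set.mem_insert _ _
  obtain h1 | h1 := h1
  · exact h1
  obtain h2 | h2 := h2
  · exact h2.symm
  have h1' : x = p y := h1
  have h2' : y = p x := h2
  exact absurd (by rw [Function.iterate_succ_apply, Function.iterate_one, ← h2', ← h1'] :
    p^[1 + 1] x = x) (hp.aperiodic 1 x)

/-- The edge from `x` to `p x` is the only one that leaves the set of descendants of `x`. -/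
lemma mem_descendants_and_not_iff {x y : V} :
    (y ∈ descendants p x ∧ p y ∉ descendants p x) ↔ y = x := by
  constructor
  · rintro ⟨⟨n, hn⟩, h⟩
    cases n with
    | zero => exact hn
    | succ n => exact absurd ⟨n, hn⟩ h
  · rintro rfl
    refine ⟨⟨0, rfl⟩, ?_⟩
    rintro ⟨n, hn⟩
    exact hp.aperiodic n y hn

-- Removing a flag disconnects the subdivided tree. Up to sign, the indicator function of one side
-- is a cochain `c` whose coboundary is 1 on that flag and 0 on all others, so the coefficients of a
-- chain can be recovered from its boundary.
open Classical in
lemma injective_boundary :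
    Function.Injective (boundary (Flag.vertex : Flag T X → _) Flag.edge) := by
  have key : ∀ f : Flag T X, ∃ c : simplices T X → ℤ, ∀ g : Flag T X,
      c g.edge - c g.vertex = if g = f then 1 else 0 := by
    intro f
    obtain ⟨x, hx, hf2, hf1⟩ := hp.exists_of_flag f
    have hne := hp.ne_self
    obtain hf1 | hf1 := hf1
    · refine ⟨fun s => if s.1 ⊆ descendants p x then -1 else 0, fun g => ?_⟩
      obtain ⟨y, hy, hg2, hg1⟩ := hp.exists_of_flag g
      have h0 := hp.mem_descendants_and_not_iff (x := x) (y := y)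
      have h1 := mem_descendants_of_apply (p := p) (x := x) (y := y)
      have hgf : g = f ↔ y = x ∧ g.1.1 = {y} := by
        constructor
        · rintro rfl
          have := hp.eq_of_pair_eq (hg2.symm.trans hf2)
          exact ⟨this, this ▸ hf1⟩
        · rintro ⟨rfl, h⟩
          exact Subtype.ext (Prod.ext (h.trans hf1.symm) (hg2.trans hf2.symm))
      obtain hg1 | hg1 := hg1
      · simp only [Flag.edge, Flag.vertex, hg1, hg2, hgf, and_true, Set.insert_subset_iff,
          Set.singleton_subset_iff]
        split_ifs <;> first | rfl | (exfalso; tauto)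
      · have : ({p y} : Set V) ≠ {y} := fun h => hne y (by simpa using h)
        simp only [Flag.edge, Flag.vertex, hg1, hg2, hgf, Set.insert_subset_iff,
          Set.singleton_subset_iff, this, and_false, if_false]
        split_ifs <;> first | rfl | (exfalso; tauto)
    -- The flag is the upper half: now the edge belongs to the lower side, hence "meets" in place of
    -- "is contained in".
    · refine ⟨fun s => if (s.1 ∩ descendants p x).Nonempty then 1 else 0, fun g => ?_⟩
      obtain ⟨y, hy, hg2, hg1⟩ := hp.exists_of_flag g
      have h0 := hp.mem_descendants_and_not_iff (x := x) (y := y)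
      have h1 := mem_descendants_of_apply (p := p) (x := x) (y := y)
      have hgf : g = f ↔ y = x ∧ g.1.1 = {p y} := by
        constructor
        · rintro rfl
          have := hp.eq_of_pair_eq (hg2.symm.trans hf2)
          exact ⟨this, this ▸ hf1⟩
        · rintro ⟨rfl, h⟩
          exact Subtype.ext (Prod.ext (h.trans hf1.symm) (hg2.trans hf2.symm))
      have h2 : (({y, p y} : Set V) ∩ descendants p x).Nonempty ↔ y ∈ descendants p x := by
        constructor
        · rintro ⟨z, rfl | rfl, hz⟩
          exacts [hz, h1 hz]
        · exact fun h => ⟨y, Or.inl rfl, h⟩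
      obtain hg1 | hg1 := hg1
      · have : ({y} : Set V) ≠ {p y} := fun h => hne y (by simpa using h.symm)
        simp only [Flag.edge, Flag.vertex, hg1, hg2, hgf, this, and_false, if_false, h2,
          Set.singleton_inter_nonempty, sub_self]
      · simp only [Flag.edge, Flag.vertex, hg1, hg2, hgf, and_true, h2,
          Set.singleton_inter_nonempty]
        split_ifs <;> first | rfl | (exfalso; tauto)
  rw [← LinearMap.ker_eq_bot, LinearMap.ker_eq_bot']
  intro z hz
  ext f
  obtain ⟨c, hc⟩ := key f
  have h1 : Finsupp.linearCombination ℤ c ∘ₗ boundary Flag.vertex Flag.edge =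
      Finsupp.lapply f := by
    refine Finsupp.lhom_ext fun g n => ?_
    simp only [LinearMap.comp_apply, boundary_single, map_sub, linearCombination_single,
      lapply_apply, single_apply, ← smul_sub, hc g]
    split_ifs <;> simp
  have h2 := LinearMap.congr_fun h1 z
  rw [LinearMap.comp_apply, hz, map_zero] at h2
  exact h2.symm

/-- Each simplex is joined to a vertex, and any two vertices climb along `p` to a common ancestor.
-/
lemma connected_boundary (s s' : simplices T X) :
    single s 1 - single s' 1 ∈
      LinearMap.range (boundary (Flag.vertex : Flag T X → _) Flag.edge) := by
  let R := LinearMap.range (boundary (Flag.vertex : Flag T X → _) Flag.edge)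
  have trans : ∀ {a b c : simplices T X}, single a (1 : ℤ) - single b 1 ∈ R →
      single b (1 : ℤ) - single c 1 ∈ R → single a (1 : ℤ) - single c 1 ∈ R := by
    intro a b c h1 h2
    have := add_mem h1 h2
    rwa [sub_add_sub_cancel] at this
  have symm : ∀ {a b : simplices T X}, single a (1 : ℤ) - single b 1 ∈ R →
      single b (1 : ℤ) - single a 1 ∈ R := by
    intro a b h
    have := neg_mem h
    rwa [neg_sub] at this
  have edge : ∀ (x : V) (hx : x ∈ X) (y : V) (hy : y ∈ X) (_ : y = x ∨ y = p x),
      single (⟨{x, p x}, hp.pair_mem_simplices hx⟩ : simplices T X) (1 : ℤ) -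
        single ⟨{y}, singleton_mem_simplices hy⟩ 1 ∈ R := by
    intro x hx y hy hxy
    have hss : ({y} : Set V) ⊂ {x, p x} := by
      have hne := hp.ne_self x
      rw [Set.ssubset_iff_subset_ne]
      refine ⟨by simpa using hxy, fun h => ?_⟩
      have h1 : x ∈ ({y} : Set V) := h ▸ Set.mem_insert _ _
      have h2 : p x ∈ ({y} : Set V) := h ▸ Set.mem_insert_of_mem _ rfl
      exact hne (h2.trans h1.symm)
    exact ⟨single ⟨({y}, {x, p x}), singleton_mem_simplices hy, hp.pair_mem_simplices hx, hss⟩ 1,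
      by rw [boundary_single]; rfl⟩
  have up : ∀ (n : ℕ) (x : V) (hx : x ∈ X), ∃ hn : p^[n] x ∈ X,
      single (⟨{x}, singleton_mem_simplices hx⟩ : simplices T X) (1 : ℤ) -
        single ⟨{p^[n] x}, singleton_mem_simplices hn⟩ 1 ∈ R := by
    intro n
    induction n with
    | zero => exact fun x hx => ⟨hx, by simp⟩
    | succ n ih =>
      intro x hx
      obtain ⟨hn, h⟩ := ih (p x) (hp.mapsTo x hx)
      exact ⟨hn, trans (trans (symm (edge x hx x hx (Or.inl rfl)))
        (edge x hx (p x) (hp.mapsTo x hx) (Or.inr rfl))) h⟩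
  have vertex : ∀ s : simplices T X, ∃ (x : V) (hx : x ∈ X),
      single s (1 : ℤ) - single ⟨{x}, singleton_mem_simplices hx⟩ 1 ∈ R := by
    rintro ⟨s, hs⟩
    obtain ⟨x, hx, rfl | rfl⟩ := hp.mem_simplices_iff.1 hs
    · exact ⟨x, hx, by simp⟩
    · exact ⟨x, hx, edge x hx x hx (Or.inl rfl)⟩
  obtain ⟨x, hx, h⟩ := vertex s
  obtain ⟨x', hx', h'⟩ := vertex s'
  obtain ⟨m, n, hmn⟩ := hp.directed x x'
  obtain ⟨hm, h1⟩ := up m x hx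
  obtain ⟨hn, h2⟩ := up n x' hx'
  refine trans h (trans h1 (trans ?_ (symm (trans h' h2))))
  simp [hmn]

lemma isAcyclicComplex : IsAcyclicComplex (Flag.vertex : Flag T X → _) Flag.edge :=
  ⟨hp.injective_boundary, hp.connected_boundary⟩

end IsParentMap

end ParentMap

end Plectic

namespace Plectic

/-! ### Groups acting on products of trees -/

section TreeAction

variable {G : Type*} [Group G] {V : Type*} {T : SimpleGraph V} {X : Set V}

/-- The action on the simplices of a graph given by an action on the vertices. -/
@[reducible] def simplexAction (φ : G →* Equiv.Perm V)
    (hφ : ∀ g, ∀ s ∈ simplices T X, φ g '' s ∈ simplices T X) : MulAction G (simplices T X) where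
  smul g s := ⟨φ g '' s.1, hφ g _ s.2⟩
  one_smul s := Subtype.ext (by change φ 1 '' s.1 = s.1; simp)
  mul_smul g h s := Subtype.ext (by
    change φ (g * h) '' s.1 = φ g '' (φ h '' s.1)
    rw [map_mul, Set.image_image]; rfl)

/-- The action on the flags of a graph given by an action on the vertices. -/
@[reducible] def flagAction (φ : G →* Equiv.Perm V)
    (hφ : ∀ g, ∀ s ∈ simplices T X, φ g '' s ∈ simplices T X) : MulAction G (Flag T X) where
  smul g f := ⟨(φ g '' f.1.1, φ g '' f.1.2), hφ g _ f.2.1, hφ g _ f.2.2.1,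
    ((φ g).injective.injOn.image_ssubset_image_iff (Set.subset_univ _) (Set.subset_univ _)).2
      f.2.2.2⟩
  one_smul f := Subtype.ext (by
    change (φ 1 '' f.1.1, φ 1 '' f.1.2) = f.1; simp)
  mul_smul g h f := Subtype.ext (by
    change (φ (g * h) '' f.1.1, φ (g * h) '' f.1.2) =
      (φ g '' (φ h '' f.1.1), φ g '' (φ h '' f.1.2))
    rw [map_mul, Set.image_image, Set.image_image]; rfl)

/-- An automorphism of prime order of a tree fixes a vertex or an edge. -/
lemma IsParentMap.exists_fixed_simplex {p : V → V} (hp : IsParentMap T X p) (hX : X.Nonempty)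
    (φ : G →* Equiv.Perm V) (hφ : ∀ g, ∀ s ∈ simplices T X, φ g '' s ∈ simplices T X) {ℓ : ℕ}
    (hℓ : ℓ.Prime) (g : G) (hg : g ^ ℓ = 1) : ∃ s ∈ simplices T X, φ g '' s = s := by
  let _ := simplexAction φ hφ
  let _ := flagAction φ hφ
  have : Nonempty (simplices T X) := ⟨⟨_, singleton_mem_simplices hX.some_mem⟩⟩
  obtain ⟨s, hs⟩ := hp.isAcyclicComplex.exists_fixed (G := G) (fun _ _ => rfl) (fun _ _ => rfl)
    hℓ g hg
  exact ⟨s.1, s.2, congrArg Subtype.val hs⟩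

end TreeAction

section TreeProduct

universe u w

variable {G : Type w} [Group G] {I : Type*} {V : I → Type u}

/-- The permutation module of a one-point set is the trivial module. -/
lemma isTypeFL_of_hasFiniteFreeRes {n : ℕ}
    (hn : HasFiniteFreeRes (MonoidAlgebra ℤ G) n (PermModule G PUnit.{u + 1})) : IsTypeFL G := by
  let e : PermModule G PUnit.{u + 1} ≃ₗ[MonoidAlgebra ℤ G]
      (Representation.trivial ℤ G ℤ).asModule :=
    { toFun := fun x => (Representation.trivial ℤ G ℤ).asModuleEquiv.symm
        (Finsupp.uniqueLinearEquiv ℤ ℤ PUnit.unit ((permRep G PUnit).asModuleEquiv x))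
      invFun := fun x => (permRep G PUnit).asModuleEquiv.symm
        ((Finsupp.uniqueLinearEquiv ℤ ℤ PUnit.unit).symm
          ((Representation.trivial ℤ G ℤ).asModuleEquiv x))
      left_inv := fun x => by
        simp only [LinearEquiv.apply_symm_apply, LinearEquiv.symm_apply_apply]
      right_inv := fun x => by
        simp only [LinearEquiv.apply_symm_apply, LinearEquiv.symm_apply_apply]
      map_add' := fun x y => by simp only [map_add]
      map_smul' := fun c v => by
        rw [LinearEquiv.symm_apply_eq, RingHom.id_apply, Representation.asModuleEquiv_map_smul,
          Representation.asModuleEquiv_map_smul, LinearEquiv.apply_symm_apply]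
        induction c using MonoidAlgebra.induction_linear with
        | zero => simp
        | add a b ha hb => simp only [map_add, LinearMap.add_apply, ha, hb]
        | single g n =>
          have : permRep G PUnit.{u + 1} g = 1 := by
            refine Finsupp.lhom_ext fun b n => ?_
            simp
          simp [Representation.asAlgebraHom_single, this] }
  exact ⟨n + 1, (hn.of_equiv e).hasExplicitRes⟩

/-- An action on a product of trees with finite stabilizers and finitely many orbits of
polysimplices. -/
structure IsProperCocompact (T : ∀ i, SimpleGraph (V i)) (X : ∀ i, Set (V i))
    (φ : ∀ i, G →* Equiv.Perm (V i)) : Prop where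
  image_mem : ∀ i g, ∀ s ∈ simplices (T i) (X i), φ i g '' s ∈ simplices (T i) (X i)
  proper : ∀ x y : ∀ i, V i, {g | ∀ i, φ i g (x i) = y i}.Finite
  cocompact : ∃ W : ∀ i, Set (V i), (∀ i, (W i).Finite) ∧ ∀ c : ∀ i, Set (V i),
    (∀ i, c i ∈ simplices (T i) (X i)) → ∃ g, ∀ i, φ i g '' c i ⊆ W i

variable {T : ∀ i, SimpleGraph (V i)} {X : ∀ i, Set (V i)} {p : ∀ i, V i → V i}
  {φ : ∀ i, G →* Equiv.Perm (V i)}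

namespace IsProperCocompact

variable (h : IsProperCocompact T X φ)
include h

/-- Restriction to a subgroup of finite index. -/
lemma restrict (H : Subgroup G) [H.FiniteIndex] :
    IsProperCocompact T X (fun i => (φ i).comp H.subtype) where
  image_mem i g s hs := h.image_mem i g s hs
  proper x y := (h.proper x y).preimage Subtype.val_injective.injOn
  cocompact := by
    obtain ⟨W, hW, hcov⟩ := h.cocompact
    -- The set `W` is enlarged by coset representatives: `g` is corrected to `q.out⁻¹ * g ∈ H`.
    refine ⟨fun i => ⋃ q : G ⧸ H, φ i q.out⁻¹ '' W i,
      fun i => Set.finite_iUnion fun q => (hW i).image _, fun c hc => ?_⟩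
    obtain ⟨g, hg⟩ := hcov c hc
    refine ⟨⟨(g : G ⧸ H).out⁻¹ * g, QuotientGroup.eq.1 (QuotientGroup.out_eq' _)⟩, fun i => ?_⟩
    rintro _ ⟨x, hx, rfl⟩
    refine Set.mem_iUnion.2 ⟨(g : G ⧸ H), φ i g x, hg i ⟨x, hx, rfl⟩, ?_⟩
    simp

variable [Finite I]

lemma finite_transporter (W W' : ∀ i, Set (V i)) (hW : ∀ i, (W i).Finite)
    (hW' : ∀ i, (W' i).Finite) :
    {g | ∃ x y : ∀ i, V i, (∀ i, x i ∈ W i) ∧ (∀ i, y i ∈ W' i) ∧ ∀ i, φ i g (x i) = y i}.Finite := by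
  have h1 : (Set.univ.pi W).Finite := Set.Finite.pi' hW |>.subset fun x hx i => hx i trivial
  have h2 : (Set.univ.pi W').Finite := Set.Finite.pi' hW' |>.subset fun x hx i => hx i trivial
  refine (h1.biUnion fun x _ => h2.biUnion fun y _ => h.proper x y).subset ?_
  rintro g ⟨x, y, hx, hy, hg⟩
  simp only [Set.mem_iUnion]
  exact ⟨x, fun i _ => hx i, y, fun i _ => hy i, hg⟩

lemma finite_stabilizer {c : ∀ i, Set (V i)} (hc : ∀ i, c i ∈ simplices (T i) (X i)) :
    {g | ∀ i, φ i g '' c i = c i}.Finite := by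
  refine (h.finite_transporter c c (fun i => finite_of_mem_simplices (hc i))
    fun i => finite_of_mem_simplices (hc i)).subset fun g hg => ?_
  choose x hx using fun i => nonempty_of_mem_simplices (hc i)
  exact ⟨x, fun i => φ i g (x i), hx, fun i => (hg i).subset ⟨_, hx i, rfl⟩, fun _ => rfl⟩

/-- Up to conjugation, there are only finitely many elements that fix a polysimplex. -/
lemma exists_finite_conj : ∃ E : Set G, E.Finite ∧ ∀ (g : G) (c : ∀ i, Set (V i)),
    (∀ i, c i ∈ simplices (T i) (X i)) → (∀ i, φ i g '' c i = c i) → ∃ a : G, a * g * a⁻¹ ∈ E := by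
  obtain ⟨W, hW, hcov⟩ := h.cocompact
  -- `E` consists of the elements that take some point of `W` to a point of `W`. If `a` moves `c`
  -- into `W`, then `a * g * a⁻¹` takes `a x` to `a g x`, both in `W`.
  refine ⟨_, h.finite_transporter W W hW hW, fun g c hc hg => ?_⟩
  obtain ⟨a, ha⟩ := hcov c hc
  choose x hx using fun i => nonempty_of_mem_simplices (hc i)
  refine ⟨a, fun i => φ i a (x i), fun i => φ i a (φ i g (x i)), fun i => ha i ⟨_, hx i, rfl⟩,
    fun i => ha i ⟨_, (hg i).subset ⟨_, hx i, rfl⟩, rfl⟩, fun i => ?_⟩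
  simp

variable (hp : ∀ i, IsParentMap (T i) (X i) (p i)) (hX : ∀ i, (X i).Nonempty)
include hp hX

/-- A torsion-free group acting properly and cocompactly on a product of trees is of type (FL). -/
theorem exists_hasFiniteFreeRes (hG : ∀ g : G, IsOfFinOrder g → g = 1) :
    ∃ n, HasFiniteFreeRes (MonoidAlgebra ℤ G) n (PermModule G PUnit.{u + 1}) := by
  cases nonempty_fintype I
  let _ := fun i => simplexAction (φ i) (h.image_mem i)
  let _ := fun i => flagAction (φ i) (h.image_mem i)
  refine exists_hasFiniteFreeRes_permModule (G := G) (fun i => simplices (T i) (X i))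
    (fun i => Flag (T i) (X i)) (fun i => Flag.vertex) (fun i => Flag.edge) (fun _ _ _ => rfl)
    (fun _ _ _ => rfl) (fun i => (hp i).isAcyclicComplex)
    (fun i => ⟨⟨_, singleton_mem_simplices (hX i).some_mem⟩⟩)
    (fun i => Flag.finite_edge_preimage) Finset.univ PUnit.{u + 1} ?_ ?_
  · intro g _ hg
    choose c hc using fun i => hg i (Finset.mem_univ i)
    apply hG
    -- The common stabilizer of the simplices `c i` is finite by properness, so `g` has finite
    -- order.
    let H : Subgroup G := ⨅ i, MulAction.stabilizer G (c i)
    have hfin : (H : Set G).Finite := by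
      refine (h.finite_stabilizer fun i => (c i).2).subset fun a ha i => ?_
      exact congrArg Subtype.val ((Subgroup.mem_iInf.1 ha i : a ∈ MulAction.stabilizer G (c i)))
    have : Finite H := hfin
    have hgH : g ∈ H := Subgroup.mem_iInf.2 fun i => hc i
    exact Submonoid.isOfFinOrder_coe.2 (isOfFinOrder_of_finite (⟨g, hgH⟩ : H))
  · obtain ⟨W, hW, hcov⟩ := h.cocompact
    refine ⟨Set.univ, fun i => {s | s.1 ⊆ W i}, Set.finite_univ, fun i =>
      (hW i).finite_subsets.preimage Subtype.val_injective.injOn, fun _ c => ?_⟩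
    obtain ⟨g, hg⟩ := hcov (fun i => (c i).1) fun i => (c i).2
    exact ⟨g, trivial, fun i _ => hg i⟩

/-- A group acting properly and cocompactly on a product of trees is finitely generated. -/
theorem fg : Group.FG G := by
  obtain ⟨W, hW, hcov⟩ := h.cocompact
  let E : Set G := {g | ∃ x y : ∀ i, V i, (∀ i, x i ∈ W i) ∧ (∀ i, y i ∈ W i) ∧
    ∀ i, φ i g (x i) = y i}
  have hE : E.Finite := h.finite_transporter W W hW hW
  suffices hH : Subgroup.closure E = ⊤ from Group.fg_iff.2 ⟨E, hH, hE⟩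
  let H := Subgroup.closure E
  let Q : G → (∀ i, V i) → Prop := fun g x => ∀ i, φ i g (x i) ∈ W i
  -- `R x y` says that all elements moving `x` and `y` into `W` agree modulo `H`. It holds inside a
  -- polysimplex, because one element moves all its vertices into `W`, and it spreads by
  -- connectedness.
  let R : (∀ i, V i) → (∀ i, V i) → Prop := fun x y => ∀ g g', Q g x → Q g' y → g' * g⁻¹ ∈ H
  have hQ : ∀ c : ∀ i, Set (V i), (∀ i, c i ∈ simplices (T i) (X i)) →
      ∃ g, ∀ x : ∀ i, V i, (∀ i, x i ∈ c i) → Q g x := fun c hc => by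
    obtain ⟨g, hg⟩ := hcov c hc
    exact ⟨g, fun x hx i => hg i ⟨_, hx i, rfl⟩⟩
  have hQ' : ∀ x : ∀ i, V i, (∀ i, x i ∈ X i) → ∃ g, Q g x := fun x hx => by
    obtain ⟨g, hg⟩ := hQ (fun i => {x i}) fun i => singleton_mem_simplices (hx i)
    exact ⟨g, hg x fun i => rfl⟩
  have refl : ∀ x, R x x := fun x g g' hg hg' =>
    Subgroup.subset_closure ⟨fun i => φ i g (x i), fun i => φ i g' (x i), hg, hg', fun i => by simp⟩
  have symm : ∀ x y, R x y → R y x := fun x y hxy g g' hg hg' => by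
    simpa using H.inv_mem (hxy g' g hg' hg)
  have trans : ∀ x y z, (∀ i, y i ∈ X i) → R x y → R y z → R x z := by
    intro x y z hy h1 h2 g g' hg hg'
    obtain ⟨a, ha⟩ := hQ' y hy
    simpa [mul_assoc] using H.mul_mem (h2 a g' ha hg') (h1 g a hg ha)
  have adj : ∀ (c : ∀ i, Set (V i)) (x y : ∀ i, V i), (∀ i, c i ∈ simplices (T i) (X i)) →
      (∀ i, x i ∈ c i) → (∀ i, y i ∈ c i) → R x y := by
    intro c x y hc hx hy g g' hg hg'
    obtain ⟨a, ha⟩ := hQ c hc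
    simpa [mul_assoc] using H.mul_mem (refl y a g' (ha y hy) hg') (refl x g a hg (ha x hx))
  have hit : ∀ i n (x : V i), x ∈ X i → (p i)^[n] x ∈ X i := fun i n x hx =>
    Set.MapsTo.iterate (fun x hx => (hp i).mapsTo x hx) n hx
  have up : ∀ (m : I → ℕ) (x : ∀ i, V i), (∀ i, x i ∈ X i) → R x fun i => (p i)^[m i] (x i) := by
    intro m x hx
    -- All coordinates climb simultaneously, the `i`-th one stopping after `m i` steps, so that
    -- consecutive tuples lie in one polysimplex.
    have key : ∀ t : ℕ, R x fun i => (p i)^[min t (m i)] (x i) := by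
      intro t
      induction t with
      | zero => simpa using refl x
      | succ t ih =>
        refine trans x _ _ (fun i => hit i _ _ (hx i)) ih (adj (fun i =>
          {(p i)^[min t (m i)] (x i), p i ((p i)^[min t (m i)] (x i))}) _ _
          (fun i => (hp i).pair_mem_simplices (hit i _ _ (hx i))) (fun i => Or.inl rfl)
          fun i => ?_)
        obtain hi | hi := le_or_gt (m i) t
        · left
          rw [min_eq_right hi, min_eq_right (by omega)]
        · right
          rw [min_eq_left hi.le, min_eq_left (by omega), Function.iterate_succ_apply']
          rfl
    obtain ⟨t, ht⟩ := (Set.finite_range m).bddAbove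
    have := key t
    simpa only [min_eq_right (ht ⟨_, rfl⟩)] using this
  have conn : ∀ x y : ∀ i, V i, (∀ i, x i ∈ X i) → (∀ i, y i ∈ X i) → R x y := by
    intro x y hx hy
    choose m n hmn using fun i => (hp i).directed (x i) (y i)
    have h1 := up m x hx
    have h2 := up n y hy
    simp only [hmn] at h1
    exact trans _ _ _ (fun i => hit i _ _ (hy i)) h1 (symm _ _ h2)
  choose x hx using hX
  obtain ⟨a, ha⟩ := hQ' x hx
  rw [eq_top_iff]
  rintro g -
  -- This translate of `x` is chosen so that `g * a` moves it to `a x`, which lies in `W`;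
  -- comparison with `a` then gives `g = (g * a) * a⁻¹ ∈ H`.
  have hb : ∀ i, φ i (a⁻¹ * g⁻¹ * a) (x i) ∈ X i := fun i => by
    have := (h.image_mem i (a⁻¹ * g⁻¹ * a) _ (singleton_mem_simplices (hx i))).1
    exact this ⟨x i, rfl, rfl⟩
  have := conn x _ hx hb a (g * a) ha (fun i => by
    rw [← Equiv.Perm.mul_apply, ← map_mul]
    have : g * a * (a⁻¹ * g⁻¹ * a) = a := by group
    rw [this]
    exact ha i)
  simpa using this

/-- A residually finite group acting properly and cocompactly on a product of trees is virtually
torsion-free. -/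
theorem isVirtuallyTorsionFree
    (hres : ∀ g : G, g ≠ 1 → ∃ N : Subgroup G, N.Normal ∧ N.FiniteIndex ∧ g ∉ N) :
    IsVirtuallyTorsionFree G := by
  obtain ⟨E, hE, hconj⟩ := h.exists_finite_conj
  choose! N hN hfi hmem using hres
  let E' : Set G := E \ {1}
  have hE' : Finite E' := (hE.sdiff).to_subtype
  -- `M` avoids all nontrivial elements of `E`, and by normality also their conjugates.
  let M : Subgroup G := ⨅ e : E', N e
  have hM : M.Normal := Subgroup.normal_iInf_normal fun e => hN e e.2.2
  refine ⟨M, ?_, ?_⟩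
  · have := fun e : E' => hfi e e.2.2
    exact Subgroup.finiteIndex_iInf (f := fun e : E' => N e) this
  · rintro ⟨g, hgM⟩ hg
    by_contra hne
    have hg' : IsOfFinOrder g := Submonoid.isOfFinOrder_coe.2 hg
    have hne' : g ≠ 1 := fun h => hne (Subtype.ext h)
    have h1 : orderOf g ≠ 1 := fun h => hne' (orderOf_eq_one_iff.1 h)
    -- It suffices to treat `g ^ k`, which has prime order `ℓ` and therefore fixes a polysimplex.
    obtain ⟨ℓ, hℓ, k, hk⟩ := Nat.exists_prime_and_dvd h1
    have hb : orderOf (g ^ k) = ℓ := by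
      have hk0 : k ≠ 0 := by
        rintro rfl
        exact hg'.orderOf_pos.ne' (by simpa using hk)
      rw [orderOf_pow_of_dvd hk0 ⟨ℓ, by rw [hk, mul_comm]⟩, hk,
        Nat.mul_div_cancel _ (Nat.pos_of_ne_zero hk0)]
    have hfix : ∀ i, ∃ s ∈ simplices (T i) (X i), φ i (g ^ k) '' s = s := fun i =>
      (hp i).exists_fixed_simplex (hX i) (φ i) (h.image_mem i) hℓ (g ^ k)
        (by rw [← hb, pow_orderOf_eq_one])
    choose c hc hgc using hfix
    obtain ⟨a, ha⟩ := hconj _ c hc hgc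
    have haM : a * g ^ k * a⁻¹ ∈ M := hM.conj_mem _ (M.pow_mem hgM k) a
    have hne2 : a * g ^ k * a⁻¹ ≠ 1 := by
      rw [Ne, conj_eq_one_iff]
      intro h
      rw [h, orderOf_one] at hb
      exact hℓ.one_lt.ne hb
    exact hmem _ hne2 (Subgroup.mem_iInf.1 haM ⟨_, ha, hne2⟩)

/-- A residually finite group acting properly and cocompactly on a product of trees is of
type (WFL). -/
theorem isTypeWFL
    (hres : ∀ g : G, g ≠ 1 → ∃ N : Subgroup G, N.Normal ∧ N.FiniteIndex ∧ g ∉ N) :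
    IsTypeWFL G := by
  refine ⟨h.isVirtuallyTorsionFree hp hX hres, fun H hH hfree => ?_⟩
  obtain ⟨n, hn⟩ := (h.restrict H).exists_hasFiniteFreeRes hp hX hfree
  exact isTypeFL_of_hasFiniteFreeRes hn

end IsProperCocompact

end TreeProduct

end Plectic

namespace Plectic

/-! ### The Bruhat–Tits tree -/

section BruhatTits

open ValuativeRel Matrix

variable {F : Type*} [Field F]

/-- The matrix of the affine transformation `x ↦ u x + b`. -/
noncomputable def affineMatrix (u : Fˣ) (b : F) : GL (Fin 2) F :=
  GeneralLinearGroup.mkOfDetNeZero !![(u : F), b; 0, 1] (by simp)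

@[simp] lemma coe_affineMatrix (u : Fˣ) (b : F) :
    (affineMatrix u b : Matrix (Fin 2) (Fin 2) F) = !![(u : F), b; 0, 1] := rfl

/-- The affine points of the projective line. -/
def affinePoint (t : F) : ℙ F (Fin 2 → F) := Projectivization.mk F ![t, 1] (by simp)

variable [ValuativeRel F]

lemma mk_mem_maxCompact {k : Matrix (Fin 2) (Fin 2) F} (hk : ∀ i j, valuation F (k i j) ≤ 1)
    (hdet : valuation F k.det = 1) {g : GL (Fin 2) F} {c : F} (hc : c ≠ 0)
    (hg : (g : Matrix (Fin 2) (Fin 2) F) = c • k) :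
    (ProjGenLinGroup.mk g : PGL(2, F)) ∈ maxCompact F := by
  let A : Matrix (Fin 2) (Fin 2) 𝒪[F] := Matrix.of fun i j => ⟨k i j, hk i j⟩
  have hA : A.map (algebraMap 𝒪[F] F) = k := by ext i j; rfl
  have hAdet : algebraMap 𝒪[F] F A.det = k.det := by
    rw [RingHom.map_det, RingHom.mapMatrix_apply, hA]
  have hu : IsUnit A.det := by
    rw [(Valuation.integer.integers (valuation F)).isUnit_iff_valuation_eq_one, hAdet, hdet]
  refine ⟨ProjGenLinGroup.mk (GeneralLinearGroup.mk'' A hu), ?_⟩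
  rw [ProjGenLinGroup.map_mk, ProjGenLinGroup.mk_eq_mk_iff]
  refine ⟨Units.mk0 c hc, ?_⟩
  ext i j
  have : (g : Matrix (Fin 2) (Fin 2) F) i j = c * k i j := by rw [hg]; rfl
  rw [this]
  have hA' : algebraMap 𝒪[F] F (A i j) = k i j := rfl
  simp [GeneralLinearGroup.coe_scalar, mul_comm, hA']

lemma exists_of_mk_mem_maxCompact {g : GL (Fin 2) F}
    (hg : (ProjGenLinGroup.mk g : PGL(2, F)) ∈ maxCompact F) :
    ∃ c : F, (∀ i j, valuation F (c * g i j) ≤ 1) ∧ valuation F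
      (c ^ 2 * (g : Matrix (Fin 2) (Fin 2) F).det) = 1 := by
  obtain ⟨k, hk⟩ := hg
  induction k using ProjGenLinGroup.induction_on with | mk k =>
  rw [ProjGenLinGroup.map_mk, eq_comm, ProjGenLinGroup.mk_eq_mk_iff] at hk
  obtain ⟨u, hu⟩ := hk
  have hk : ∀ i j, (u : F) * g i j = algebraMap 𝒪[F] F (k i j) := fun i j => by
    have := congrArg (fun h : GL (Fin 2) F => h i j) hu
    simpa [GeneralLinearGroup.coe_scalar, mul_comm] using this
  refine ⟨u, fun i j => ?_, ?_⟩
  · rw [hk]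
    exact (k i j).2
  · have h1 : (u : F) ^ 2 * (g : Matrix (Fin 2) (Fin 2) F).det =
        algebraMap 𝒪[F] F (k : Matrix (Fin 2) (Fin 2) 𝒪[F]).det := by
      rw [det_fin_two, det_fin_two, map_sub, map_mul, map_mul, ← hk, ← hk, ← hk, ← hk]
      ring
    rw [h1, ← (Valuation.integer.integers (valuation F)).isUnit_iff_valuation_eq_one]
    exact (GeneralLinearGroup.det k).isUnit

lemma coe_mk_eq {g h : GL (Fin 2) F} {k : Matrix (Fin 2) (Fin 2) F} {c : F} (hc : c ≠ 0)
    (hk : ∀ i j, valuation F (k i j) ≤ 1) (hdet : valuation F k.det = 1)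
    (hgh : (g : Matrix (Fin 2) (Fin 2) F) = c • ((h : Matrix (Fin 2) (Fin 2) F) * k)) :
    ((ProjGenLinGroup.mk g : PGL(2, F)) : Vertex F) = (ProjGenLinGroup.mk h : PGL(2, F)) := by
  symm
  rw [QuotientGroup.eq, ← map_inv, ← map_mul]
  refine mk_mem_maxCompact hk hdet hc ?_
  rw [GeneralLinearGroup.coe_mul, hgh, Matrix.mul_smul, ← Matrix.mul_assoc,
    ← GeneralLinearGroup.coe_mul, inv_mul_cancel, GeneralLinearGroup.coe_one, Matrix.one_mul]

/-- The vertex of the tree given by the ball of radius `|u|` around `b`. -/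
noncomputable def ballVertex (u : Fˣ) (b : F) : Vertex F := (ProjGenLinGroup.mk (affineMatrix u b) : PGL(2, F))

/-- The quotient of the two matrices is the affine matrix with entries `u' / u` and `(b' - b) / u`;
it remains to decide when a multiple of it is integral with unit determinant. -/
lemma ballVertex_eq_iff {u u' : Fˣ} {b b' : F} : ballVertex u b = ballVertex u' b' ↔
    valuation F u = valuation F u' ∧ valuation F (b' - b) ≤ valuation F u := by
  have hu : valuation F (u : F) ≠ 0 := by simp
  have hmat : ((affineMatrix u b)⁻¹ * affineMatrix u' b' : GL (Fin 2) F) =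
      affineMatrix (u⁻¹ * u') ((u : F)⁻¹ * (b' - b)) := by
    rw [inv_mul_eq_iff_eq_mul]
    ext i j
    fin_cases i <;> fin_cases j <;> simp [Matrix.mul_apply, Fin.sum_univ_two]
  rw [ballVertex, ballVertex, QuotientGroup.eq, ← map_inv, ← map_mul, hmat]
  constructor
  · intro h
    obtain ⟨c, h1, h2⟩ := exists_of_mk_mem_maxCompact h
    have h00 := h1 0 0
    have h01 := h1 0 1
    have h11 := h1 1 1
    simp only [coe_affineMatrix, det_fin_two_of, Matrix.of_apply, Matrix.cons_val',
      Matrix.cons_val_zero, Matrix.cons_val_one, map_mul, map_pow, mul_one, mul_zero, sub_zero,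
      Units.val_mul] at h00 h01 h11 h2
    simp only [Units.val_inv_eq_inv_val, map_inv₀] at h00 h01 h2
    set x := valuation F c
    set y := (valuation F (u : F))⁻¹ * valuation F (u' : F)
    -- The scalar `c` satisfies `x ≤ 1`, `x * y ≤ 1` and `x ^ 2 * y = 1`, so `1 = x * (x * y) ≤ x`.
    have hx : x = 1 := by
      refine le_antisymm h11 ?_
      rw [← h2, pow_two, mul_assoc]
      exact mul_le_of_le_one_right' h00
    rw [hx, one_pow, one_mul] at h2
    rw [hx, one_mul] at h01
    refine ⟨?_, ?_⟩
    · rwa [inv_mul_eq_one₀ hu] at h2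
    · rwa [inv_mul_le_iff₀ (zero_lt_iff.2 hu), mul_one] at h01
  · rintro ⟨h1, h2⟩
    have h3 : (valuation F (u : F))⁻¹ * valuation F (u' : F) = 1 := by
      rw [inv_mul_eq_one₀ hu, h1]
    have h4 : (valuation F (u : F))⁻¹ * valuation F (b' - b) ≤ 1 := by
      rwa [inv_mul_le_iff₀ (zero_lt_iff.2 hu), mul_one]
    refine mk_mem_maxCompact (k := (affineMatrix (u⁻¹ * u') ((u : F)⁻¹ * (b' - b))).1) (c := 1)
      ?_ ?_ one_ne_zero (by rw [one_smul])
    · intro i j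
      fin_cases i <;> fin_cases j <;> simp [h3, h4]
    · simp [h3]

lemma ballVertex_congr {u u' : Fˣ} {b b' : F} (h : valuation F u = valuation F u') (hb : b = b') :
    ballVertex u b = ballVertex u' b' :=
  ballVertex_eq_iff.2 ⟨h, by simp [hb]⟩

/-- Iwasawa decomposition: the larger entry of the bottom row clears the other one by an integral
column operation, and is then scaled to 1. -/
lemma coe_mk_eq_ballVertex_of_le {g : GL (Fin 2) F} (h : valuation F (g 1 0) ≤ valuation F (g 1 1))
    (h0 : g 1 1 ≠ 0) : ((ProjGenLinGroup.mk g : PGL(2, F)) : Vertex F) =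
      ballVertex (GeneralLinearGroup.det g / Units.mk0 (g 1 1) h0 ^ 2) (g 0 1 / g 1 1) := by
  have hv : valuation F (g 1 1) ≠ 0 := by simpa using h0
  refine coe_mk_eq (k := !![1, 0; g 1 0 / g 1 1, 1]) h0 ?_ (by simp) ?_
  · intro i j
    fin_cases i <;> fin_cases j <;> simp
    rwa [div_le_one₀ (zero_lt_iff.2 hv)]
  · ext i j
    fin_cases i <;> fin_cases j <;>
      simp [det_fin_two] <;> field_simp
    ring

lemma coe_mk_eq_ballVertex_of_ge {g : GL (Fin 2) F} (h : valuation F (g 1 1) ≤ valuation F (g 1 0))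
    (h0 : g 1 0 ≠ 0) : ((ProjGenLinGroup.mk g : PGL(2, F)) : Vertex F) =
      ballVertex (GeneralLinearGroup.det g / Units.mk0 (g 1 0) h0 ^ 2) (g 0 0 / g 1 0) := by
  have hv : valuation F (g 1 0) ≠ 0 := by simpa using h0
  refine coe_mk_eq (k := !![0, -1; 1, g 1 1 / g 1 0]) h0 ?_ (by simp) ?_
  · intro i j
    fin_cases i <;> fin_cases j <;> simp
    rwa [div_le_one₀ (zero_lt_iff.2 hv)]
  · ext i j
    fin_cases i <;> fin_cases j <;>
      simp [det_fin_two] <;> field_simp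
    ring

/-- Besides the ball, this records that its centre can be taken to be one of the two ends of the
geodesic defined by `g`. -/
lemma exists_coe_mk_eq_ballVertex (g : GL (Fin 2) F) : ∃ u t,
    ((ProjGenLinGroup.mk g : PGL(2, F)) : Vertex F) = ballVertex u t ∧
      ((ProjGenLinGroup.mk g : PGL(2, F)) • projInfty F = affinePoint t ∨
        (ProjGenLinGroup.mk g : PGL(2, F)) • projZero F = affinePoint t) := by
  have hdet : (g : Matrix (Fin 2) (Fin 2) F).det ≠ 0 := GeneralLinearGroup.det_ne_zero g
  rw [det_fin_two] at hdet
  obtain h | h := le_total (valuation F (g 1 0)) (valuation F (g 1 1))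
  · have h0 : g 1 1 ≠ 0 := by
      intro h0
      rw [h0, map_zero, le_zero_iff, map_eq_zero] at h
      simp [h0, h] at hdet
    refine ⟨_, _, coe_mk_eq_ballVertex_of_le h h0, Or.inr ?_⟩
    rw [projZero, affinePoint, Projectivization.PGL.mk_smul_mk, Projectivization.mk_eq_mk_iff']
    refine ⟨g 1 1, ?_⟩
    ext i
    fin_cases i <;>
      simp [Units.smul_def, Matrix.smul_eq_mulVec, Matrix.mulVec, dotProduct, mul_div_cancel₀, h0]
  · have h0 : g 1 0 ≠ 0 := by
      intro h0
      rw [h0, map_zero, le_zero_iff, map_eq_zero] at h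
      simp [h0, h] at hdet
    refine ⟨_, _, coe_mk_eq_ballVertex_of_ge h h0, Or.inl ?_⟩
    rw [projInfty, affinePoint, Projectivization.PGL.mk_smul_mk, Projectivization.mk_eq_mk_iff']
    refine ⟨g 1 0, ?_⟩
    ext i
    fin_cases i <;>
      simp [Units.smul_def, Matrix.smul_eq_mulVec, Matrix.mulVec, dotProduct, mul_div_cancel₀, h0]

lemma exists_eq_ballVertex (x : Vertex F) : ∃ u t, x = ballVertex u t := by
  induction x using QuotientGroup.induction_on with | H x =>
  induction x using ProjGenLinGroup.induction_on with | mk g =>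
  obtain ⟨u, t, h, -⟩ := exists_coe_mk_eq_ballVertex g
  exact ⟨u, t, h⟩

end BruhatTits

end Plectic

namespace Plectic

/-! ### The action of `PGL₂(F)` on the projective line -/

section ProjectiveLine

open Matrix

variable {F : Type*} [Field F]

lemma affinePoint_ne_projInfty (t : F) : affinePoint t ≠ projInfty F := by
  rw [affinePoint, projInfty, Ne, Projectivization.mk_eq_mk_iff']
  rintro ⟨c, hc⟩
  have := congrFun hc 1
  simp at this

lemma eq_projInfty_or_affinePoint (a : ℙ F (Fin 2 → F)) :
    a = projInfty F ∨ ∃ t, a = affinePoint t := by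
  induction a using Projectivization.ind with | h v hv =>
  by_cases h : v 1 = 0
  · left
    rw [projInfty, Projectivization.mk_eq_mk_iff']
    refine ⟨v 0, ?_⟩
    ext i
    fin_cases i <;> simp [h]
  · right
    refine ⟨v 0 / v 1, ?_⟩
    rw [affinePoint, Projectivization.mk_eq_mk_iff']
    refine ⟨v 1, ?_⟩
    ext i
    fin_cases i <;> simp [mul_div_cancel₀, h]

lemma affineMatrix_smul_projInfty (u : Fˣ) (t : F) :
    (ProjGenLinGroup.mk (affineMatrix u t) : PGL(2, F)) • projInfty F = projInfty F := by
  rw [projInfty, Projectivization.PGL.mk_smul_mk, Projectivization.mk_eq_mk_iff']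
  refine ⟨u, ?_⟩
  ext i
  fin_cases i <;> simp [Units.smul_def, Matrix.smul_eq_mulVec]

lemma affineMatrix_smul_projZero (u : Fˣ) (t : F) :
    (ProjGenLinGroup.mk (affineMatrix u t) : PGL(2, F)) • projZero F = affinePoint t := by
  rw [projZero, affinePoint, Projectivization.PGL.mk_smul_mk, Projectivization.mk_eq_mk_iff']
  refine ⟨1, ?_⟩
  ext i
  fin_cases i <;> simp [Units.smul_def, Matrix.smul_eq_mulVec]

lemma exists_smul_eq_projInfty (a : ℙ F (Fin 2 → F)) : ∃ g : PGL(2, F), g • a = projInfty F := by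
  obtain rfl | ⟨t, rfl⟩ := eq_projInfty_or_affinePoint a
  · exact ⟨1, one_smul _ _⟩
  · let g : GL (Fin 2) F := GeneralLinearGroup.mkOfDetNeZero !![0, 1; 1, -t] (by simp)
    refine ⟨ProjGenLinGroup.mk g, ?_⟩
    rw [affinePoint, projInfty, Projectivization.PGL.mk_smul_mk, Projectivization.mk_eq_mk_iff']
    refine ⟨1, ?_⟩
    ext i
    fin_cases i <;> simp [g, GeneralLinearGroup.mkOfDetNeZero, Units.smul_def,
      Matrix.smul_eq_mulVec]

end ProjectiveLine

/-! ### The subtree attached to a set of ends and its parent map -/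

section BruhatTits

open ValuativeRel Matrix

variable {F : Type*} [Field F] [ValuativeRel F]

lemma smul_mem_geodesic {a b : ℙ F (Fin 2 → F)} {x : Vertex F} (h : PGL(2, F))
    (hx : x ∈ geodesic a b) : h • x ∈ geodesic (h • a) (h • b) := by
  obtain ⟨g, rfl, rfl, rfl⟩ := hx
  exact ⟨h * g, mul_smul _ _ _, mul_smul _ _ _, rfl⟩

lemma smul_mem_limitTree {L L' : Set (ℙ F (Fin 2 → F))} (h : PGL(2, F))
    (hL : ∀ a ∈ L, h • a ∈ L') {x : Vertex F} (hx : x ∈ limitTree L) : h • x ∈ limitTree L' := by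
  obtain ⟨a, ha, b, hb, hab, hx⟩ := hx
  exact ⟨h • a, hL a ha, h • b, hL b hb, fun h' => hab (smul_left_cancel h h'),
    smul_mem_geodesic h hx⟩

lemma bruhatTitsTree_adj_smul (h : PGL(2, F)) {x y : Vertex F} :
    (bruhatTitsTree F).Adj (h • x) (h • y) ↔ (bruhatTitsTree F).Adj x y := by
  have key : ∀ (h : PGL(2, F)) {x y : Vertex F},
      (bruhatTitsTree F).Adj x y → (bruhatTitsTree F).Adj (h • x) (h • y) := by
    intro h x y hxy
    induction h using ProjGenLinGroup.induction_on with | mk h =>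
    rw [bruhatTitsTree, SimpleGraph.fromRel_adj] at hxy ⊢
    obtain ⟨hne, hr⟩ := hxy
    refine ⟨fun h' => hne (smul_left_cancel _ h'), hr.imp ?_ ?_⟩ <;>
    · rintro ⟨ϖ, g, d, hϖ, hd, rfl, rfl⟩
      exact ⟨ϖ, h * g, d, hϖ, hd, rfl, by rw [mul_assoc]; rfl⟩
  refine ⟨fun hxy => ?_, key h⟩
  simpa using key h⁻¹ hxy

/-- Tripod argument: a vertex on the geodesic from `a` to `b` also lies on the geodesic from `∞` to
`a` or on the one from `∞` to `b`. -/
lemma mem_limitTree_iff {L : Set (ℙ F (Fin 2 → F))} (hL : projInfty F ∈ L) {x : Vertex F} :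
    x ∈ limitTree L ↔ ∃ u t, affinePoint t ∈ L ∧ x = ballVertex u t := by
  constructor
  · rintro ⟨a, ha, b, hb, -, g, rfl, rfl, rfl⟩
    induction g using ProjGenLinGroup.induction_on with | mk g =>
    obtain ⟨u, t, h, ht⟩ := exists_coe_mk_eq_ballVertex g
    obtain ht | ht := ht
    exacts [⟨u, t, ht ▸ ha, h⟩, ⟨u, t, ht ▸ hb, h⟩]
  · rintro ⟨u, t, ht, rfl⟩
    exact ⟨_, hL, _, ht, (affinePoint_ne_projInfty t).symm, _, affineMatrix_smul_projInfty u t,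
      affineMatrix_smul_projZero u t, rfl⟩

lemma geodesic_nonempty {a b : ℙ F (Fin 2 → F)} (hab : a ≠ b) : (geodesic a b).Nonempty := by
  obtain ⟨h, hh⟩ := exists_smul_eq_projInfty a
  obtain hb | ⟨t, ht⟩ := eq_projInfty_or_affinePoint (h • b)
  · exact absurd (smul_left_cancel h (hh.trans hb.symm)) hab
  · have := smul_mem_geodesic h⁻¹ (x := ballVertex 1 t) (a := projInfty F) (b := affinePoint t)
      ⟨_, affineMatrix_smul_projInfty 1 t, affineMatrix_smul_projZero 1 t, rfl⟩
    rw [← hh, ← ht, inv_smul_smul, inv_smul_smul] at this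
    exact ⟨_, this⟩

lemma limitTree_nonempty {L : Set (ℙ F (Fin 2 → F))} (hL : L.Nonempty) (hL' : ∀ x, L ≠ {x}) :
    (limitTree L).Nonempty := by
  obtain ⟨a, ha⟩ := hL
  obtain ⟨b, hb, hab⟩ : ∃ b ∈ L, a ≠ b := by
    by_contra! h
    exact hL' a (Set.eq_singleton_iff_unique_mem.2 ⟨ha, fun b hb => (h b hb).symm⟩)
  obtain ⟨x, hx⟩ := geodesic_nonempty hab
  exact ⟨x, a, ha, b, hb, hab, hx⟩

/-- Division of the radius of a ball by `ϖ`. -/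
noncomputable def parent (ϖ : Fˣ) (x : Vertex F) : Vertex F :=
  ballVertex ((exists_eq_ballVertex x).choose / ϖ) (exists_eq_ballVertex x).choose_spec.choose

/-- Independence of the chosen radius and centre: a larger ball around any point of the given one is
the same ball. -/
lemma parent_ballVertex {ϖ : Fˣ} (hϖ : valuation F ϖ ≤ 1) (u : Fˣ) (t : F) :
    parent ϖ (ballVertex u t) = ballVertex (u / ϖ) t := by
  have h := (exists_eq_ballVertex (ballVertex u t)).choose_spec.choose_spec
  obtain ⟨h1, h2⟩ := ballVertex_eq_iff.1 h
  rw [parent, eq_comm, ballVertex_eq_iff]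
  have h0 : valuation F (ϖ : F) ≠ 0 := by simp
  constructor
  · simp [h1]
  · refine h2.trans ?_
    rw [Units.val_div_eq_div_val, map_div₀, le_div_iff₀ (zero_lt_iff.2 h0)]
    exact mul_le_of_le_one_right' hϖ

lemma parent_iterate_ballVertex {ϖ : Fˣ} (hϖ : valuation F ϖ ≤ 1) (n : ℕ) (u : Fˣ) (t : F) :
    (parent ϖ)^[n] (ballVertex u t) = ballVertex (u / ϖ ^ n) t := by
  induction n generalizing u with
  | zero => simp
  | succ n ih => rw [Function.iterate_succ_apply, parent_ballVertex hϖ, ih, pow_succ', div_div]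

section Uniformizer

variable {ϖ : 𝒪[F]} (hϖ : Irreducible ϖ)
include hϖ

lemma valuation_uniformizer_lt_one : valuation F (ϖ : F) < 1 := by
  refine lt_of_le_of_ne ϖ.2 fun h => hϖ.not_isUnit ?_
  rwa [(Valuation.integer.integers (valuation F)).isUnit_iff_valuation_eq_one]

lemma uniformizer_ne_zero : (ϖ : F) ≠ 0 := fun h => hϖ.ne_zero (Subtype.ext h)

variable [IsDiscreteValuationRing 𝒪[F]]

lemma exists_valuation_eq_zpow {x : F} (hx : x ≠ 0) :
    ∃ n : ℤ, valuation F x = valuation F (ϖ : F) ^ n := by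
  have key : ∀ x : F, x ≠ 0 → valuation F x ≤ 1 →
      ∃ n : ℕ, valuation F x = valuation F (ϖ : F) ^ n := by
    intro x hx h
    obtain ⟨n, u, hu⟩ := IsDiscreteValuationRing.eq_unit_mul_pow_irreducible
      (x := (⟨x, h⟩ : 𝒪[F])) (fun h' => hx (congrArg Subtype.val h')) hϖ
    refine ⟨n, ?_⟩
    have h1 : x = (u : 𝒪[F]) * (ϖ : F) ^ n := congrArg Subtype.val hu
    have h2 : valuation F ((u : 𝒪[F]) : F) = 1 :=
      (Valuation.integer.integers (valuation F)).isUnit_iff_valuation_eq_one.1 u.isUnit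
    rw [h1, map_mul, map_pow, h2, one_mul]
  obtain h | h := le_total (valuation F x) 1
  · obtain ⟨n, hn⟩ := key x hx h
    exact ⟨n, by rw [hn, zpow_natCast]⟩
  · have h0 : valuation F x ≠ 0 := by simpa using hx
    obtain ⟨n, hn⟩ := key x⁻¹ (inv_ne_zero hx) (by
      rw [map_inv₀]; exact inv_le_one_of_one_le₀ h)
    refine ⟨-n, ?_⟩
    rw [_root_.zpow_neg, zpow_natCast, ← hn, map_inv₀, inv_inv]

lemma valuation_eq_of_irreducible {ϖ' : 𝒪[F]} (hϖ' : Irreducible ϖ') :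
    valuation F (ϖ' : F) = valuation F (ϖ : F) := by
  obtain ⟨u, hu⟩ := IsDiscreteValuationRing.associated_of_irreducible _ hϖ hϖ'
  have h2 : valuation F ((u : 𝒪[F]) : F) = 1 :=
    (Valuation.integer.integers (valuation F)).isUnit_iff_valuation_eq_one.1 u.isUnit
  have h1 : (ϖ' : F) = (ϖ : F) * (u : 𝒪[F]) := congrArg Subtype.val hu.symm
  rw [h1, map_mul, h2, mul_one]

/-- Multiplying the first column of `g` by a uniformizer shrinks the ball by one step if the second
column dominates in the bottom row, and enlarges it by one step otherwise. -/
lemma bruhatTitsTree_adj_iff (x y : Vertex F) : (bruhatTitsTree F).Adj x y ↔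
    y = parent (Units.mk0 (ϖ : F) (uniformizer_ne_zero hϖ)) x ∨
      x = parent (Units.mk0 (ϖ : F) (uniformizer_ne_zero hϖ)) y := by
  set π := Units.mk0 (ϖ : F) (uniformizer_ne_zero hϖ)
  have hπ : valuation F (π : F) ≤ 1 := ϖ.2
  have hπ1 : valuation F (π : F) < 1 := valuation_uniformizer_lt_one hϖ
  have hπ0 : valuation F (π : F) ≠ 0 := by simp
  have hrel : ∀ x y : Vertex F, (∃ (ϖ : 𝒪[F]) (g d : GL (Fin 2) F),
      Irreducible ϖ ∧ (d : Matrix (Fin 2) (Fin 2) F) = !![(ϖ : F), 0; 0, 1] ∧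
      x = (ProjGenLinGroup.mk g : PGL(2, F)) ∧ y = (ProjGenLinGroup.mk (g * d) : PGL(2, F))) →
      y = parent π x ∨ x = parent π y := by
    rintro x y ⟨ϖ', g, d, hϖ', hd, rfl, rfl⟩
    have hv := valuation_eq_of_irreducible hϖ hϖ'
    have hϖ0 : (ϖ' : F) ≠ 0 := uniformizer_ne_zero hϖ'
    have hdet : (g : Matrix (Fin 2) (Fin 2) F).det ≠ 0 := GeneralLinearGroup.det_ne_zero g
    rw [det_fin_two] at hdet
    have e0 : ∀ i, (g * d) i 0 = g i 0 * ϖ' := fun i => by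
      simp [hd, Matrix.mul_apply, Fin.sum_univ_two]
    have e1 : ∀ i, (g * d) i 1 = g i 1 := fun i => by
      simp [hd, Matrix.mul_apply, Fin.sum_univ_two]
    have hdd : ((GeneralLinearGroup.det d : Fˣ) : F) = ϖ' := by simp [hd]
    obtain h | h := le_or_gt (valuation F (g 1 0)) (valuation F (g 1 1))
    · right
      have h0 : g 1 1 ≠ 0 := by
        intro h0
        rw [h0, map_zero, le_zero_iff, map_eq_zero] at h
        simp [h0, h] at hdet
      have h' : valuation F ((g * d) 1 0) ≤ valuation F ((g * d) 1 1) := by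
        rw [e0, e1, map_mul]
        exact (mul_le_of_le_one_right' ϖ'.2).trans h
      rw [coe_mk_eq_ballVertex_of_le h h0, coe_mk_eq_ballVertex_of_le h' (by rwa [e1]),
        parent_ballVertex hπ]
      refine ballVertex_congr ?_ (by rw [e1, e1])
      simp only [e1, map_mul, Units.val_div_eq_div_val, Units.val_mul, Units.val_pow_eq_pow_val,
        Units.val_mk0, map_div₀, hdd, map_pow, π, hv]
      have := hπ0
      simp only [π, Units.val_mk0] at this
      field_simp
    · left
      have h0 : g 1 0 ≠ 0 := by
        intro h0
        rw [h0, map_zero] at h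
        exact not_lt_zero h
      have hv0 : valuation F (g 1 0) ≠ 0 := by simpa using h0
      have h' : valuation F ((g * d) 1 1) ≤ valuation F ((g * d) 1 0) := by
        rw [e0, e1, map_mul, hv]
        obtain h1 | h1 := eq_or_ne (g 1 1) 0
        · simp [h1]
        have h2 : valuation F (g 1 1 / g 1 0) < 1 := by
          rwa [map_div₀, div_lt_one₀ (zero_lt_iff.2 hv0)]
        obtain ⟨n, hn⟩ := exists_valuation_eq_zpow hϖ (div_ne_zero h1 h0)
        rw [hn] at h2
        -- Discreteness: a value less than 1 is at most that of `ϖ`, so the first column still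
        -- dominates after scaling.
        have hn1 : 1 ≤ n := by
          by_contra hn1
          have : n ≤ 0 := by omega
          exact absurd h2 (not_lt.2 (one_le_zpow_of_nonpos₀ (zero_lt_iff.2 hπ0) hπ this))
        have h3 : valuation F (g 1 1 / g 1 0) ≤ valuation F (ϖ : F) := by
          rw [hn]
          calc valuation F (ϖ : F) ^ n ≤ valuation F (ϖ : F) ^ (1 : ℤ) :=
                zpow_le_zpow_right_of_le_one₀ (zero_lt_iff.2 hπ0) hπ hn1
            _ = _ := zpow_one _
        rwa [map_div₀, div_le_iff₀ (zero_lt_iff.2 hv0), mul_comm] at h3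
      have h0' : (g * d) 1 0 ≠ 0 := by rw [e0]; exact mul_ne_zero h0 hϖ0
      rw [coe_mk_eq_ballVertex_of_ge h.le h0, coe_mk_eq_ballVertex_of_ge h' h0',
        parent_ballVertex hπ]
      refine ballVertex_congr ?_ (by rw [e0, e0, mul_div_mul_right _ _ hϖ0])
      simp only [e0, map_mul, Units.val_div_eq_div_val, Units.val_mul, Units.val_pow_eq_pow_val,
        Units.val_mk0, map_div₀, hdd, map_pow, π, hv]
      have := hπ0
      simp only [π, Units.val_mk0] at this
      field_simp
  rw [bruhatTitsTree, SimpleGraph.fromRel_adj]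
  constructor
  · rintro ⟨-, h | h⟩
    exacts [hrel x y h, (hrel y x h).symm]
  · have hback : ∀ x : Vertex F, x ≠ parent π x ∧ ∃ (ϖ : 𝒪[F]) (g d : GL (Fin 2) F),
        Irreducible ϖ ∧ (d : Matrix (Fin 2) (Fin 2) F) = !![(ϖ : F), 0; 0, 1] ∧
        parent π x = (ProjGenLinGroup.mk g : PGL(2, F)) ∧
        x = (ProjGenLinGroup.mk (g * d) : PGL(2, F)) := by
      intro x
      obtain ⟨u, t, rfl⟩ := exists_eq_ballVertex x
      rw [parent_ballVertex hπ]
      constructor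
      · intro h
        have h1 := (ballVertex_eq_iff.1 h).1
        have hu0 : valuation F (u : F) ≠ 0 := by simp
        rw [Units.val_div_eq_div_val, map_div₀, eq_div_iff hπ0] at h1
        exact hπ1.ne (mul_left_cancel₀ hu0 (h1.trans (mul_one _).symm))
      · refine ⟨ϖ, affineMatrix (u / π) t, affineMatrix π 0, hϖ, rfl, rfl, ?_⟩
        have : affineMatrix (u / π) t * affineMatrix π 0 = affineMatrix u t := by
          ext i j
          fin_cases i <;> fin_cases j <;>
            simp [Matrix.mul_apply, Fin.sum_univ_two]
        rw [this]
        rfl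
    rintro (rfl | rfl)
    · exact ⟨(hback x).1, Or.inr (hback x).2⟩
    · exact ⟨(hback y).1.symm, Or.inl (hback y).2⟩

lemma isParentMap_parent {L : Set (ℙ F (Fin 2 → F))} (hL : projInfty F ∈ L) :
    IsParentMap (bruhatTitsTree F) (limitTree L)
      (parent (Units.mk0 (ϖ : F) (uniformizer_ne_zero hϖ))) := by
  set π := Units.mk0 (ϖ : F) (uniformizer_ne_zero hϖ)
  have hπ : valuation F (π : F) ≤ 1 := ϖ.2
  have hπ1 : valuation F (π : F) < 1 := valuation_uniformizer_lt_one hϖ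
  have hπ0 : valuation F (π : F) ≠ 0 := by simp
  refine ⟨?_, ?_, ?_, bruhatTitsTree_adj_iff hϖ⟩
  · intro x hx
    obtain ⟨u, t, ht, rfl⟩ := (mem_limitTree_iff hL).1 hx
    exact (mem_limitTree_iff hL).2 ⟨_, t, ht, parent_ballVertex hπ u t⟩
  · intro n x h
    obtain ⟨u, t, rfl⟩ := exists_eq_ballVertex x
    rw [parent_iterate_ballVertex hπ] at h
    have h1 := (ballVertex_eq_iff.1 h).1
    have hu0 : valuation F (u : F) ≠ 0 := by simp
    rw [Units.val_div_eq_div_val, map_div₀, Units.val_pow_eq_pow_val, map_pow,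
      div_eq_iff (pow_ne_zero _ hπ0)] at h1
    have h2 := mul_left_cancel₀ hu0 ((mul_one _).trans h1)
    exact (pow_lt_one₀ zero_le hπ1 n.succ_ne_zero).ne h2.symm
  · intro x y
    obtain ⟨u, t, rfl⟩ := exists_eq_ballVertex x
    obtain ⟨u', t', rfl⟩ := exists_eq_ballVertex y
    obtain ⟨n, hn⟩ := exists_valuation_eq_zpow hϖ u.ne_zero
    obtain ⟨n', hn'⟩ := exists_valuation_eq_zpow hϖ u'.ne_zero
    obtain ⟨N, hN⟩ : ∃ N : ℕ, valuation F (t' - t) ≤ valuation F (π : F) ^ (-(N : ℤ)) := by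
      by_cases h0 : t' - t = 0
      · exact ⟨0, by simp [h0]⟩
      · obtain ⟨m, hm⟩ := exists_valuation_eq_zpow hϖ h0
        refine ⟨m.natAbs, ?_⟩
        rw [hm]
        exact zpow_le_zpow_right_of_le_one₀ (zero_lt_iff.2 hπ0) hπ (by omega)
    -- Both balls are enlarged to the radius `|ϖ| ^ (-K)` with `K = N + |n| + |n'|`. The summand `N`
    -- covers the distance of the centres; the others keep `n + K` and `n' + K` nonnegative.
    refine ⟨(n + (N + n.natAbs + n'.natAbs)).toNat, (n' + (N + n.natAbs + n'.natAbs)).toNat, ?_⟩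
    rw [parent_iterate_ballVertex hπ, parent_iterate_ballVertex hπ, ballVertex_eq_iff]
    have h1 : ∀ (u : Fˣ) (n : ℤ) (K : ℤ), valuation F (u : F) = valuation F (ϖ : F) ^ n →
        0 ≤ n + K → valuation F ((u / π ^ (n + K).toNat : Fˣ) : F) = valuation F (π : F) ^ (-K) := by
      intro u n K hu hK
      rw [Units.val_div_eq_div_val, map_div₀, Units.val_pow_eq_pow_val, map_pow, hu,
        ← zpow_natCast, Int.toNat_of_nonneg hK]
      change valuation F (π : F) ^ n / _ = _
      rw [← zpow_sub₀ hπ0]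
      congr 1
      ring
    rw [h1 u n _ hn (by omega), h1 u' n' _ hn' (by omega)]
    refine ⟨rfl, hN.trans ?_⟩
    exact zpow_le_zpow_right_of_le_one₀ (zero_lt_iff.2 hπ0) hπ (by omega)

end Uniformizer

/-- The subtree attached to a nonempty set of ends has a parent map. -/
theorem exists_isParentMap [IsDiscreteValuationRing 𝒪[F]] {L : Set (ℙ F (Fin 2 → F))}
    (hL : L.Nonempty) : ∃ p, IsParentMap (bruhatTitsTree F) (limitTree L) p := by
  obtain ⟨a, ha⟩ := hL
  obtain ⟨h, hh⟩ := exists_smul_eq_projInfty a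
  obtain ⟨ϖ, hϖ⟩ := IsDiscreteValuationRing.exists_irreducible 𝒪[F]
  -- The end `a` is moved to `∞` by `h`, and the parent map there is conjugated back.
  have hp := isParentMap_parent hϖ (L := (h • ·) '' L) ⟨a, ha, hh⟩
  set q := parent (Units.mk0 (ϖ : F) (uniformizer_ne_zero hϖ))
  have hq : ∀ n x, (fun x => h⁻¹ • q (h • x))^[n] x = h⁻¹ • q^[n] (h • x) := by
    intro n
    induction n with
    | zero => simp
    | succ n ih => intro x; simp only [Function.iterate_succ_apply, ih, smul_inv_smul]
  refine ⟨fun x => h⁻¹ • q (h • x), ?_, ?_, ?_, ?_⟩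
  · intro x hx
    have h1 := hp.mapsTo _ (smul_mem_limitTree h (fun a ha => Set.mem_image_of_mem _ ha) hx)
    refine smul_mem_limitTree h⁻¹ ?_ h1
    rintro _ ⟨a, ha, rfl⟩
    simpa using ha
  · intro n x hx
    rw [hq, inv_smul_eq_iff] at hx
    exact hp.aperiodic n _ hx
  · intro x y
    obtain ⟨m, n, hmn⟩ := hp.directed (h • x) (h • y)
    exact ⟨m, n, by rw [hq, hq, hmn]⟩
  · intro x y
    rw [← bruhatTitsTree_adj_smul h, hp.adj, eq_inv_smul_iff, eq_inv_smul_iff]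

end BruhatTits

end Plectic

namespace Plectic

/-! ### Sequential compactness of `GL₂(𝒪)` -/

section LocalField

open ValuativeRel Matrix

variable (F : Type*) [Field F] [ValuativeRel F] [TopologicalSpace F] [IsNonarchimedeanLocalField F]

/-- The value group is countable, so 0 has a countable basis of balls. This allows convergent
subsequences to be extracted in `GL₂(𝒪)`. -/
lemma firstCountableTopology_localField : FirstCountableTopology F := by
  have hc : Countable (ValueGroupWithZero F) := by
    have : Countable (Multiplicative ℤ) := inferInstanceAs (Countable ℤ)
    have : Countable (WithZero (Multiplicative ℤ)) := inferInstanceAs (Countable (Option _))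
    exact (IsNonarchimedeanLocalField.valueGroupWithZeroIsoInt F).injective.countable
  have h0 : (𝓝 (0 : F)).IsCountablyGenerated :=
    (IsValuativeTopology.hasBasis_nhds_zero' F).isCountablyGenerated
  refine ⟨fun a => ?_⟩
  rw [← map_add_left_nhds_zero]
  infer_instance

lemma t2Space_localField : T2Space F := by
  let _ := IsTopologicalAddGroup.rightUniformSpace F
  have := isUniformAddGroup_of_addCommGroup (G := F)
  have : T0Space F := inferInstance
  infer_instance

lemma compactSpace_generalLinearGroup : CompactSpace (GL (Fin 2) 𝒪[F]) := by
  have := t2Space_localField F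
  have : CompactSpace (Matrix (Fin 2) (Fin 2) 𝒪[F]) :=
    inferInstanceAs (CompactSpace (Fin 2 → Fin 2 → 𝒪[F]))
  exact (Units.isClosedEmbedding_embedProduct (α := Matrix (Fin 2) (Fin 2) 𝒪[F])).compactSpace

lemma firstCountableTopology_generalLinearGroup :
    FirstCountableTopology (GL (Fin 2) 𝒪[F]) := by
  have := firstCountableTopology_localField F
  have : FirstCountableTopology 𝒪[F] := Topology.IsInducing.subtypeVal.firstCountableTopology
  have : FirstCountableTopology (Matrix (Fin 2) (Fin 2) 𝒪[F]) :=
    inferInstanceAs (FirstCountableTopology (Fin 2 → Fin 2 → 𝒪[F]))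
  have : FirstCountableTopology (Matrix (Fin 2) (Fin 2) 𝒪[F])ᵐᵒᵖ :=
    MulOpposite.opHomeomorph.symm.isInducing.firstCountableTopology
  exact (Units.isInducing_embedProduct (M := Matrix (Fin 2) (Fin 2) 𝒪[F])).firstCountableTopology

end LocalField

/-! ### Field embeddings and continuity on projective lines -/

section ProjectiveLine

open ValuativeRel Matrix

variable {F C : Type*} [Field F] [Field C]

lemma projLineMap_projInfty (ι : F →+* C) : projLineMap ι (projInfty F) = projInfty C := by
  rw [projInfty, projLineMap, Projectivization.map_mk, projInfty]
  congr 1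
  ext i
  fin_cases i <;> simp [coordMap]

lemma projLineMap_affinePoint (ι : F →+* C) (t : F) :
    projLineMap ι (affinePoint t) = affinePoint (ι t) := by
  rw [affinePoint, projLineMap, Projectivization.map_mk, affinePoint]
  congr 1
  ext i
  fin_cases i <;> simp [coordMap]

lemma affinePoint_injective : Function.Injective (affinePoint : F → ℙ F (Fin 2 → F)) := by
  intro s t h
  rw [affinePoint, affinePoint, Projectivization.mk_eq_mk_iff'] at h
  obtain ⟨d, hd⟩ := h
  have h0 := congrFun hd 0
  have h1 := congrFun hd 1
  simp only [Pi.smul_apply, cons_val_zero, cons_val_one, smul_eq_mul, mul_one] at h0 h1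
  rw [← h0, h1, one_mul]

lemma projLineMap_injective (ι : F →+* C) : Function.Injective (projLineMap ι) := by
  intro a b h
  obtain rfl | ⟨s, rfl⟩ := eq_projInfty_or_affinePoint a <;>
  obtain rfl | ⟨t, rfl⟩ := eq_projInfty_or_affinePoint b
  · rfl
  · rw [projLineMap_projInfty, projLineMap_affinePoint] at h
    exact absurd h.symm (affinePoint_ne_projInfty _)
  · rw [projLineMap_projInfty, projLineMap_affinePoint] at h
    exact absurd h (affinePoint_ne_projInfty _)
  · rw [projLineMap_affinePoint, projLineMap_affinePoint] at h
    rw [ι.injective (affinePoint_injective h)]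

lemma projLineMap_smul (ι : F →+* C) (g : PGL(2, F)) (a : ℙ F (Fin 2 → F)) :
    projLineMap ι (g • a) = ProjGenLinGroup.map ι g • projLineMap ι a := by
  induction g using ProjGenLinGroup.induction_on with | mk g =>
  induction a using Projectivization.ind with | h v hv =>
  rw [ProjGenLinGroup.map_mk, Projectivization.PGL.mk_smul_mk, projLineMap,
    Projectivization.map_mk, Projectivization.map_mk, Projectivization.PGL.mk_smul_mk]
  congr 1
  ext i
  exact RingHom.map_mulVec ι g.1 v i

lemma exists_notMem_range_projLineMap (ι : F →+* C) (h : ∃ c, c ∉ Set.range ι) :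
    ∃ z, z ∉ Set.range (projLineMap ι) := by
  obtain ⟨c, hc⟩ := h
  refine ⟨affinePoint c, ?_⟩
  rintro ⟨a, ha⟩
  obtain rfl | ⟨t, rfl⟩ := eq_projInfty_or_affinePoint a
  · rw [projLineMap_projInfty] at ha
    exact affinePoint_ne_projInfty c ha.symm
  · rw [projLineMap_affinePoint] at ha
    exact hc ⟨t, affinePoint_injective ha⟩

variable [TopologicalSpace C] [IsTopologicalRing C]

lemma continuous_smul_projLine (g : PGL(2, C)) :
    Continuous fun x : ℙ C (Fin 2 → C) => g • x := by
  induction g using ProjGenLinGroup.induction_on with | mk g =>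
  refine continuous_coinduced_dom.2 ?_
  have : Continuous fun v : {v : Fin 2 → C // v ≠ 0} =>
      (⟨g • v.1, (smul_ne_zero_iff_ne g).2 v.2⟩ : {v : Fin 2 → C // v ≠ 0}) := by
    refine Continuous.subtype_mk ?_ _
    exact Continuous.matrix_mulVec continuous_const continuous_subtype_val
  exact continuous_coinduced_rng.comp this

/-- The image in `PGL₂(C)` of an integral matrix. -/
noncomputable def integralMap [ValuativeRel F] (ι : F →+* C) : GL (Fin 2) 𝒪[F] →* PGL(2, C) :=
  (ProjGenLinGroup.map ι).comp ((ProjGenLinGroup.map (algebraMap 𝒪[F] F)).comp ProjGenLinGroup.mk)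

lemma continuous_integralMap_smul [ValuativeRel F] [TopologicalSpace F] {ι : F →+* C}
    (hι : Continuous ι) (z : ℙ C (Fin 2 → C)) :
    Continuous fun A : GL (Fin 2) 𝒪[F] => integralMap ι A • z := by
  induction z using Projectivization.ind with | h v hv =>
  let B : GL (Fin 2) 𝒪[F] → GL (Fin 2) C := fun A =>
    GeneralLinearGroup.map ι (GeneralLinearGroup.map (algebraMap 𝒪[F] F) A)
  have : Continuous fun A : GL (Fin 2) 𝒪[F] =>
      (⟨B A • v, (smul_ne_zero_iff_ne (B A)).2 hv⟩ : {v : Fin 2 → C // v ≠ 0}) := by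
    refine Continuous.subtype_mk ?_ _
    refine Continuous.matrix_mulVec (A := fun A => (B A).1) ?_ continuous_const
    refine continuous_matrix fun i j => ?_
    exact hι.comp (continuous_subtype_val.comp (Units.continuous_val.matrix_elem i j))
  exact continuous_coinduced_rng.comp this

end ProjectiveLine

end Plectic

namespace Plectic

/-! ### Reduction to integral matrices -/

section IntegralMap

open ValuativeRel Matrix

variable {F C : Type*} [Field F] [Field C] [ValuativeRel F]

/-- `ℙ¹(F)` is one orbit of `GL₂(𝒪)`. This controls the coordinates with `L i` empty, where no
vertex is available. -/
lemma exists_integralMap_smul_projInfty (ι : F →+* C) (g : PGL(2, F)) :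
    ∃ A : GL (Fin 2) 𝒪[F],
      ProjGenLinGroup.map ι g • projInfty C = integralMap ι A • projInfty C := by
  suffices h : ∀ a : ℙ F (Fin 2 → F), ∃ A : GL (Fin 2) 𝒪[F],
      a = ProjGenLinGroup.map (algebraMap 𝒪[F] F) (ProjGenLinGroup.mk A) • projInfty F by
    obtain ⟨A, hA⟩ := h (g • projInfty F)
    refine ⟨A, ?_⟩
    rw [← projLineMap_projInfty ι, ← projLineMap_smul, hA, projLineMap_smul]
    rfl
  intro a
  obtain rfl | ⟨t, rfl⟩ := eq_projInfty_or_affinePoint a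
  · exact ⟨1, by simp⟩
  · obtain ht | ht := le_total (valuation F t) 1
    · let A : Matrix (Fin 2) (Fin 2) 𝒪[F] := !![⟨t, ht⟩, -1; 1, 0]
      have hA : IsUnit A.det := by simp [A]
      refine ⟨GeneralLinearGroup.mk'' A hA, ?_⟩
      rw [ProjGenLinGroup.map_mk, projInfty, affinePoint, Projectivization.PGL.mk_smul_mk,
        Projectivization.mk_eq_mk_iff']
      refine ⟨1, ?_⟩
      have h : (GeneralLinearGroup.map (algebraMap 𝒪[F] F) (GeneralLinearGroup.mk'' A hA)).1 =
          !![t, -1; 1, 0] := by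
        ext i j
        fin_cases i <;> fin_cases j <;> rfl
      ext i
      fin_cases i <;> simp [Units.smul_def, h, Matrix.smul_eq_mulVec]
    · have ht0 : t ≠ 0 := by
        rintro rfl
        simp at ht
      let A : Matrix (Fin 2) (Fin 2) 𝒪[F] := !![1, 0; ⟨t⁻¹, by
        change valuation F t⁻¹ ≤ 1
        rw [map_inv₀]
        exact inv_le_one_of_one_le₀ ht⟩, 1]
      have hA : IsUnit A.det := by simp [A]
      refine ⟨GeneralLinearGroup.mk'' A hA, ?_⟩
      rw [ProjGenLinGroup.map_mk, projInfty, affinePoint, Projectivization.PGL.mk_smul_mk,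
        Projectivization.mk_eq_mk_iff']
      refine ⟨t, ?_⟩
      have h : (GeneralLinearGroup.map (algebraMap 𝒪[F] F) (GeneralLinearGroup.mk'' A hA)).1 =
          !![1, 0; t⁻¹, 1] := by
        ext i j
        fin_cases i <;> fin_cases j <;> rfl
      ext i
      fin_cases i <;> simp [Units.smul_def, h, Matrix.smul_eq_mulVec, ht0]

/-- Elements that move one vertex to another are given by integral matrices. -/
lemma exists_integralMap_of_smul_eq (ι : F →+* C) (x y : Vertex F) :
    ∃ h h' : PGL(2, F), ∀ g : PGL(2, F), g • x = y → ∃ A : GL (Fin 2) 𝒪[F],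
      ∀ z : ℙ C (Fin 2 → C), ProjGenLinGroup.map ι g • ProjGenLinGroup.map ι h • z =
        ProjGenLinGroup.map ι h' • integralMap ι A • z := by
  induction x using QuotientGroup.induction_on with | H h =>
  induction y using QuotientGroup.induction_on with | H h' =>
  refine ⟨h, h', fun g hg => ?_⟩
  have h1 : ((h' : PGL(2, F)) : Vertex F) = ((g * h : PGL(2, F)) : Vertex F) := hg.symm
  rw [QuotientGroup.eq] at h1
  obtain ⟨k, hk⟩ := h1
  induction k using ProjGenLinGroup.induction_on with | mk A =>
  refine ⟨A, fun z => ?_⟩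
  have h2 : g * h = h' * ProjGenLinGroup.map (algebraMap 𝒪[F] F) (ProjGenLinGroup.mk A) := by
    rw [hk, mul_inv_cancel_left]
  rw [← mul_smul, ← map_mul, h2, map_mul, mul_smul]
  rfl

end IntegralMap

/-! ### Properness and cocompactness for plectic groups -/

section Plectic

open Matrix

variable {S : Type*} {F : S → Type*} [∀ i, Field (F i)] {C : Type*} [Field C]
  [TopologicalSpace C] {ι : ∀ i, F i →+* C} {Γ : Subgroup (∀ i, PGL(2, F i))}
  {L : ∀ i, Set (ℙ (F i) (Fin 2 → F i))}

lemma smul_mem_limitSet [IsTopologicalRing C] {g : ∀ i, PGL(2, F i)} (hg : g ∈ Γ)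
    {x : S → ℙ C (Fin 2 → C)} (hx : x ∈ limitSet ι Γ) :
    (fun i => ProjGenLinGroup.map (ι i) (g i) • x i) ∈ limitSet ι Γ := by
  obtain ⟨y, γ, hinj, hmem, hlim⟩ := hx
  refine ⟨y, fun j => g * γ j, fun j k h => hinj (mul_left_cancel h),
    fun j => Γ.mul_mem hg (hmem j), tendsto_pi_nhds.2 fun i => ?_⟩
  simp only [Pi.mul_apply, map_mul, mul_smul]
  exact ((continuous_smul_projLine _).tendsto _).comp (tendsto_pi_nhds.1 hlim i)

/-- The sets of ends of a plectic group are stable under the group. -/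
lemma IsPlecticWith.smul_mem [IsTopologicalRing C] (h : IsPlecticWith ι Γ L)
    (hns : ∀ i, ∃ c, c ∉ Set.range (ι i)) {g : ∀ i, PGL(2, F i)} (hg : g ∈ Γ) (i : S)
    {a : ℙ (F i) (Fin 2 → F i)} (ha : a ∈ L i) : g i • a ∈ L i := by
  classical
  choose z hz using fun i => exists_notMem_range_projLineMap (ι i) (hns i)
  -- All coordinates except the `i`-th are non-rational and stay so under `Γ`, so the translate can
  -- be in the limit set only because of its `i`-th coordinate.
  have hx : Function.update z i (projLineMap (ι i) a) ∈ limitSet ι Γ := by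
    rw [h]
    exact ⟨i, by simpa using Set.mem_image_of_mem _ ha⟩
  have hgx := smul_mem_limitSet hg hx
  rw [h] at hgx
  obtain ⟨j, b, hb, hbj⟩ := hgx
  dsimp only at hbj
  by_cases hij : j = i
  · subst hij
    rw [Function.update_self, ← projLineMap_smul] at hbj
    rwa [← projLineMap_injective _ hbj]
  · rw [Function.update_of_ne hij] at hbj
    refine absurd ⟨(g j)⁻¹ • b, ?_⟩ (hz j)
    rw [projLineMap_smul, hbj, map_inv, inv_smul_smul]

variable [Finite S] [∀ i, ValuativeRel (F i)] [∀ i, TopologicalSpace (F i)]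
  [∀ i, IsNonarchimedeanLocalField (F i)]

/-- A plectic group acts properly on the product of the trees with a nonempty set of ends. -/
lemma IsPlecticWith.finite_transporter [IsTopologicalRing C] (h : IsPlecticWith ι Γ L)
    (hι : ∀ i, Continuous (ι i)) (hns : ∀ i, ∃ c, c ∉ Set.range (ι i))
    (x y : ∀ i : {i // (L i).Nonempty}, Vertex (F i)) :
    {g : Γ | ∀ i : {i // (L i).Nonempty}, g.1 i • x i = y i}.Finite := by
  by_contra hinf
  let γ := Set.Infinite.natEmbedding _ hinf
  -- A starting point `w` such that, in each coordinate, `γ j w` varies only through the integral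
  -- matrix `A j`. The point `z` is non-rational wherever `L i` is nonempty.
  have hdata : ∀ i, ∃ (w z : ℙ C (Fin 2 → C)) (h' : PGL(2, F i)) (A : ℕ → GL (Fin 2) 𝒪[F i]),
      (∀ j, ProjGenLinGroup.map (ι i) ((γ j).1.1 i) • w =
        ProjGenLinGroup.map (ι i) h' • integralMap (ι i) (A j) • z) ∧
      ((L i).Nonempty → z ∉ Set.range (projLineMap (ι i))) := by
    intro i
    by_cases hi : (L i).Nonempty
    · obtain ⟨z, hz⟩ := exists_notMem_range_projLineMap (ι i) (hns i)
      obtain ⟨h, h', hh⟩ := exists_integralMap_of_smul_eq (ι i) (x ⟨i, hi⟩) (y ⟨i, hi⟩)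
      choose A hA using fun j => hh ((γ j).1.1 i) ((γ j).2 ⟨i, hi⟩)
      exact ⟨ProjGenLinGroup.map (ι i) h • z, z, h', A, fun j => hA j z, fun _ => hz⟩
    · choose A hA using fun j => exists_integralMap_smul_projInfty (ι i) ((γ j).1.1 i)
      exact ⟨projInfty C, projInfty C, 1, A, fun j => by rw [hA, map_one, one_smul],
        fun h => absurd h hi⟩
  choose w z h' A hA hz using hdata
  have := fun i => compactSpace_generalLinearGroup (F i)
  have := fun i => firstCountableTopology_generalLinearGroup (F i)
  have := Finite.to_countable (α := S)
  obtain ⟨B, φ, hφ, hB⟩ := CompactSpace.tendsto_subseq fun j i => A i j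
  have hlim : (fun i => ProjGenLinGroup.map (ι i) (h' i) • integralMap (ι i) (B i) • z i) ∈
      limitSet ι Γ := by
    refine ⟨w, fun j => (γ (φ j)).1.1, ?_, fun j => (γ (φ j)).1.2, tendsto_pi_nhds.2 fun i => ?_⟩
    · exact fun j k hjk => hφ.injective (γ.injective (Subtype.ext (Subtype.ext hjk)))
    · simp only [hA]
      exact (((continuous_smul_projLine _).comp
        (continuous_integralMap_smul (hι i) (z i))).tendsto _).comp (tendsto_pi_nhds.1 hB i)
  rw [h] at hlim
  obtain ⟨i, b, hb, hbi⟩ := hlim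
  -- The limit is a translate of `z i` by an element of `PGL₂(F i)`, so its rationality would make
  -- `z i` rational.
  refine hz i ⟨b, hb⟩ ⟨(ProjGenLinGroup.map (algebraMap 𝒪[F i] (F i))
    (ProjGenLinGroup.mk (B i)))⁻¹ • (h' i)⁻¹ • b, ?_⟩
  rw [projLineMap_smul, projLineMap_smul, hbi, map_inv, map_inv, inv_smul_smul]
  exact inv_smul_smul _ _

/-- A normal plectic group acts properly and cocompactly on the product of its trees. -/
lemma IsPlecticWith.isProperCocompact [IsTopologicalRing C] (h : IsPlecticWith ι Γ L)
    (hι : ∀ i, Continuous (ι i)) (hns : ∀ i, ∃ c, c ∉ Set.range (ι i))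
    (hfin : (polyOrbit Γ '' polysimplices L).Finite) :
    IsProperCocompact (I := {i // (L i).Nonempty}) (V := fun i => Vertex (F i))
      (fun i => bruhatTitsTree (F i)) (fun i => limitTree (L i))
      (fun i => (MulAction.toPermHom PGL(2, F i) (Vertex (F i))).comp
        ((Pi.evalMonoidHom (fun i => PGL(2, F i)) i.1).comp Γ.subtype)) where
  image_mem i g s hs := by
    obtain ⟨hs, hs'⟩ := hs
    refine ⟨?_, hs'.imp ?_ ?_⟩
    · rintro _ ⟨x, hx, rfl⟩
      exact smul_mem_limitTree _ (fun a ha => h.smul_mem hns g.2 i ha) (hs hx)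
    · rintro ⟨x, rfl⟩
      exact ⟨_, Set.image_singleton⟩
    · rintro ⟨x, y, hxy, rfl⟩
      exact ⟨_, _, (bruhatTitsTree_adj_smul (g.1 i)).2 hxy, Set.image_pair _ _ _⟩
  proper x y := h.finite_transporter hι hns x y
  cocompact := by
    have hrep : ∀ o : (polyOrbit Γ '' polysimplices L), ∃ c ∈ polysimplices L,
        polyOrbit Γ c = o.1 := fun o => o.2
    choose c hc hco using hrep
    have := hfin.to_subtype
    -- `W` is the union of one representative from each orbit; `limitTreeSimplices` and `simplices`
    -- agree by definition.
    refine ⟨fun i => ⋃ o, c o i, fun i => Set.finite_iUnion fun o =>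
      finite_of_mem_simplices (T := bruhatTitsTree (F i)) (X := limitTree (L i)) (hc o i), ?_⟩
    intro d hd
    let o : (polyOrbit Γ '' polysimplices L) := ⟨polyOrbit Γ d, d, hd, rfl⟩
    have hdo : d ∈ polyOrbit Γ (c o) := by
      rw [hco o]
      exact ⟨1, Γ.one_mem, fun i => by simp⟩
    obtain ⟨γ, hγ, hd'⟩ := hdo
    refine ⟨⟨γ, hγ⟩⁻¹, fun i => ?_⟩
    rw [hd' i]
    rintro _ ⟨_, ⟨x, hx, rfl⟩, rfl⟩
    refine Set.mem_iUnion.2 ⟨o, ?_⟩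
    have : ((γ i)⁻¹ • (γ i • x)) ∈ c o i := by rwa [inv_smul_smul]
    exact this

end Plectic

/-! ### Points of the completed algebraic closure outside a local field -/

section CompletedAlgClosure

open ValuativeRel

/-- A nonarchimedean local field has no surjective continuous homomorphism to the completed
algebraic closure of a field. -/
lemma exists_notMem_range_completedAlgClosure {k : Type*} [NontriviallyNormedField k]
    [IsUltrametricDist k] [CompleteSpace k] {F : Type*} [Field F] [ValuativeRel F]
    [TopologicalSpace F] [IsNonarchimedeanLocalField F] (ι : F →+* CompletedAlgClosure k)
    (hι : Continuous ι) : ∃ c, c ∉ Set.range ι := by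
  by_contra! hsurj
  obtain ⟨x, hx0, hx1⟩ := NormedField.exists_norm_lt_one k
  let x' : AlgCl k := algebraMap k (AlgebraicClosure k) x
  have hx' : ‖x'‖ = ‖x‖ := spectralNorm_extends x
  have hroot : ∀ n : ℕ, 0 < n → ∃ y : AlgCl k, y ^ n = x' := fun n hn =>
    IsAlgClosed.exists_pow_nat_eq (k := AlgebraicClosure k) x' hn
  obtain ⟨f, hf⟩ := hsurj (x' : CompletedAlgClosure k)
  have hfn : ‖ι f‖ = ‖x‖ := by rw [hf, UniformSpace.Completion.norm_coe, hx']
  have hf0 : f ≠ 0 := by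
    rintro rfl
    rw [map_zero, norm_zero] at hfn
    exact hx0.ne hfn
  obtain ⟨ϖ, hϖ⟩ := IsDiscreteValuationRing.exists_irreducible 𝒪[F]
  obtain ⟨m, hm⟩ := exists_valuation_eq_zpow hϖ hf0
  have hϖ0 : valuation F (ϖ : F) ≠ 0 := by simpa using uniformizer_ne_zero hϖ
  -- If `ι` were surjective, `f` would have a root of order `|m| + 1` in `F`, so `|m| + 1` would
  -- divide `m`.
  have hm0 : m = 0 := by
    obtain ⟨y, hy⟩ := hroot (m.natAbs + 1) (Nat.succ_pos _)
    obtain ⟨e, he⟩ := hsurj (y : CompletedAlgClosure k)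
    have hef : e ^ (m.natAbs + 1) = f := by
      apply ι.injective
      rw [map_pow, he, hf, ← hy]
      exact (map_pow (UniformSpace.Completion.coeRingHom (α := AlgCl k)) y _).symm
    have he0 : e ≠ 0 := by
      rintro rfl
      rw [zero_pow (Nat.succ_ne_zero _)] at hef
      exact hf0 hef.symm
    obtain ⟨m', hm'⟩ := exists_valuation_eq_zpow hϖ he0
    rw [← hef, map_pow, hm', ← zpow_natCast, ← zpow_mul] at hm
    have h1 := zpow_right_injective₀ (zero_lt_iff.2 hϖ0) (valuation_uniformizer_lt_one hϖ).ne hm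
    refine Int.eq_zero_of_abs_lt_dvd (m := ((m.natAbs + 1 : ℕ) : ℤ)) ⟨m', by rw [mul_comm, h1]⟩ ?_
    rw [Int.abs_eq_natAbs]
    omega
  rw [hm0, zpow_zero] at hm
  -- Now `f` is a unit of the valuation ring although `‖ι f‖ < 1`: the powers of `f⁻¹` stay in a
  -- compact set while their images are unbounded.
  have hK : IsCompact (ι '' {y | valuation F y ≤ 1}) :=
    (IsNonarchimedeanLocalField.isCompact_closedBall F 1).image hι
  obtain ⟨R, hR⟩ := hK.isBounded.exists_norm_le
  obtain ⟨n, hn⟩ := pow_unbounded_of_one_lt R ((one_lt_inv₀ hx0).2 hx1)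
  have h1 : valuation F (f⁻¹ ^ n) ≤ 1 := by rw [map_pow, map_inv₀, hm, inv_one, one_pow]
  have h2 := hR _ ⟨_, h1, rfl⟩
  rw [map_pow, map_inv₀, norm_pow, norm_inv, hfn] at h2
  exact absurd hn (not_lt.2 h2)

end CompletedAlgClosure

end Plectic

namespace Plectic

/-! ### Residual finiteness of finitely generated projective linear groups -/

section ResidualFiniteness

open Matrix

/-- For the zero ideal, a nonzero integer is not divisible by a prime larger than its absolute
value. -/
lemma isJacobsonRing_int : IsJacobsonRing ℤ := by
  rw [isJacobsonRing_iff_prime_eq]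
  intro P hP
  rcases eq_or_ne P ⊥ with rfl | h
  · refine le_antisymm (fun x hx => ?_) Ideal.le_jacobson
    rw [Ideal.mem_bot]
    by_contra hx0
    obtain ⟨q, hq, hqp⟩ := Nat.exists_infinite_primes (x.natAbs + 1)
    have hmax : (Ideal.span {(q : ℤ)}).IsMaximal :=
      PrincipalIdealRing.isMaximal_of_irreducible
        (Int.prime_iff_natAbs_prime.2 (by simpa using hqp)).irreducible
    have hmem : x ∈ Ideal.span {(q : ℤ)} := Ideal.mem_sInf.1 hx ⟨bot_le, hmax⟩
    rw [Ideal.mem_span_singleton, Int.natCast_dvd] at hmem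
    exact absurd (Nat.le_of_dvd (Int.natAbs_pos.2 hx0) hmem) (by omega)
  · have := hP.isMaximal h
    exact Ideal.jacobson_eq_self_of_isMaximal

/-- A field that is a finitely generated ring is finite. -/
lemma finite_of_finiteType_int (κ : Type*) [CommRing κ] (hκ : IsField κ)
    [hft : Algebra.FiniteType ℤ κ] : Finite κ := by
  let _ : Field κ := hκ.toField
  have := isJacobsonRing_int
  -- Zariski's lemma over a Jacobson ring. As `ℤ` is not a field, it does not embed into `κ`, so `κ`
  -- is a finitely generated torsion group.
  have hfin : Module.Finite ℤ κ := @finite_of_finite_type_of_isJacobsonRing ℤ κ _ _ _ _ hft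
  refine Module.finite_of_fg_torsion κ ?_
  obtain ⟨n, hn, hn0⟩ : ∃ n : ℤ, (n : κ) = 0 ∧ n ≠ 0 := by
    by_contra! hinj
    have hinj' : Function.Injective (algebraMap ℤ κ) :=
      (injective_iff_map_eq_zero _).2 fun n hn => hinj n (by simpa using hn)
    exact Int.not_isField (isField_of_isIntegral_of_isField hinj' (Field.toIsField κ))
  refine fun x => ⟨⟨n, mem_nonZeroDivisors_of_ne_zero hn0⟩, ?_⟩
  change n • x = 0
  rw [zsmul_eq_mul, hn, zero_mul]

/-- A nonzero element of a finitely generated domain is nonzero in some finite residue field. -/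
lemma exists_isMaximal_notMem_finite_quotient {R : Type*} [CommRing R] [IsDomain R]
    [Algebra.FiniteType ℤ R] {u : R} (hu : u ≠ 0) :
    ∃ m : Ideal R, m.IsMaximal ∧ u ∉ m ∧ Finite (R ⧸ m) := by
  have := isJacobsonRing_int
  have : IsJacobsonRing R := isJacobsonRing_of_finiteType (A := ℤ)
  have hbot : (⊥ : Ideal R).jacobson = ⊥ :=
    isJacobsonRing_iff_prime_eq.1 this ⊥ Ideal.isPrime_bot
  have hu' : u ∉ (⊥ : Ideal R).jacobson := by rwa [hbot, Ideal.mem_bot]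
  rw [Ideal.jacobson, Ideal.mem_sInf] at hu'
  push Not at hu'
  obtain ⟨m, ⟨-, hm⟩, hum⟩ := hu'
  refine ⟨m, hm, hum, ?_⟩
  have hft : Algebra.FiniteType ℤ (R ⧸ m) :=
    Algebra.FiniteType.of_surjective (Ideal.Quotient.mkₐ ℤ m) Ideal.Quotient.mk_surjective
  exact finite_of_finiteType_int (R ⧸ m)
    ((Ideal.Quotient.maximal_ideal_iff_isField_quotient m).1 hm) (hft := hft)

lemma projGenLinGroup_mk_eq_one_iff {R : Type*} [CommRing R] (A : GL (Fin 2) R) :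
    (ProjGenLinGroup.mk A : PGL(2, R)) = 1 ↔ A 0 1 = 0 ∧ A 1 0 = 0 ∧ A 0 0 = A 1 1 := by
  rw [ProjGenLinGroup.mk_eq_one, GeneralLinearGroup.center_eq_range_scalar]
  constructor
  · rintro ⟨u, rfl⟩
    simp
  · rintro ⟨h01, h10, h00⟩
    have hdet : IsUnit (A 0 0) := by
      have : IsUnit (A : Matrix (Fin 2) (Fin 2) R).det := isUnits_det_units A
      rw [det_fin_two] at this
      exact isUnit_of_mul_isUnit_left (by simpa [h01] using this)
    refine ⟨hdet.unit, ?_⟩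
    ext i j
    fin_cases i <;> fin_cases j <;> simp [h01, h10, h00]

lemma projGenLinGroup_map_injective {R K : Type*} [CommRing R] [CommRing K] (f : R →+* K)
    (hf : Function.Injective f) :
    Function.Injective (ProjGenLinGroup.map f : PGL(2, R) →* PGL(2, K)) := by
  rw [injective_iff_map_eq_one]
  intro x hx
  obtain ⟨A, rfl⟩ := ProjGenLinGroup.mk_surjective x
  rw [ProjGenLinGroup.map_mk, projGenLinGroup_mk_eq_one_iff] at hx
  rw [projGenLinGroup_mk_eq_one_iff]
  simp only [GeneralLinearGroup.map_apply] at hx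
  exact ⟨hf (by simpa using hx.1), hf (by simpa using hx.2.1), hf hx.2.2⟩

/-- `PGL₂` of a finitely generated domain is residually finite. -/
lemma exists_hom_finite_projGenLinGroup {R : Type*} [CommRing R] [IsDomain R]
    [Algebra.FiniteType ℤ R] {x : PGL(2, R)} (hx : x ≠ 1) :
    ∃ m : Ideal R, Finite (R ⧸ m) ∧ ProjGenLinGroup.map (Ideal.Quotient.mk m) x ≠ 1 := by
  obtain ⟨A, rfl⟩ := ProjGenLinGroup.mk_surjective x
  -- `u` is an off-diagonal entry or the difference of the diagonal entries, whichever shows that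
  -- `A` is not scalar.
  obtain ⟨u, hu, hA⟩ : ∃ u : R, u ≠ 0 ∧ ∀ m : Ideal R, u ∉ m →
      ProjGenLinGroup.map (Ideal.Quotient.mk m) (ProjGenLinGroup.mk A : PGL(2, R)) ≠ 1 := by
    simp only [ne_eq, ProjGenLinGroup.map_mk, projGenLinGroup_mk_eq_one_iff,
      GeneralLinearGroup.map_apply, Ideal.Quotient.eq_zero_iff_mem, Ideal.Quotient.eq]
    rw [ne_eq, projGenLinGroup_mk_eq_one_iff] at hx
    by_cases h01 : A 0 1 = 0
    · by_cases h10 : A 1 0 = 0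
      · exact ⟨A 0 0 - A 1 1, fun h => hx ⟨h01, h10, sub_eq_zero.1 h⟩, fun m hm h => hm h.2.2⟩
      · exact ⟨A 1 0, h10, fun m hm h => hm h.2.1⟩
    · exact ⟨A 0 1, h01, fun m hm h => hm h.1⟩
  obtain ⟨m, -, hum, hfin⟩ := exists_isMaximal_notMem_finite_quotient hu
  exact ⟨m, hfin, hA m hum⟩

/-- An invertible matrix comes from a subring containing its entries and those of its inverse. -/
lemma mem_range_generalLinearGroup_map {K : Type*} [CommRing K] (R : Subalgebra ℤ K)
    (A : GL (Fin 2) K) (h : ∀ i j, A i j ∈ R) (h' : ∀ i j, A⁻¹ i j ∈ R) :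
    A ∈ (GeneralLinearGroup.map (n := Fin 2) (algebraMap R K)).range := by
  have hinj : Function.Injective (algebraMap R K) := Subtype.val_injective
  have hmap : Function.Injective
      ((algebraMap R K).mapMatrix : Matrix (Fin 2) (Fin 2) R →+* Matrix (Fin 2) (Fin 2) K) :=
    Matrix.map_injective hinj
  let B : Matrix (Fin 2) (Fin 2) R := Matrix.of fun i j => ⟨A i j, h i j⟩
  let B' : Matrix (Fin 2) (Fin 2) R := Matrix.of fun i j => ⟨A⁻¹ i j, h' i j⟩
  have hB : (algebraMap R K).mapMatrix B = (A : Matrix (Fin 2) (Fin 2) K) := rfl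
  have hB' : (algebraMap R K).mapMatrix B' = ((A⁻¹ : GL (Fin 2) K) : Matrix (Fin 2) (Fin 2) K) :=
    rfl
  refine ⟨⟨B, B', hmap ?_, hmap ?_⟩, ?_⟩
  · rw [map_mul, hB, hB', map_one, Units.mul_inv]
  · rw [map_mul, hB, hB', map_one, Units.inv_mul]
  · ext i j
    rfl

/-- Finitely generated groups of projective linear transformations are residually finite. -/
theorem exists_normal_finiteIndex_notMem {G : Type*} [Group G] [Group.FG G] {K : Type*} [Field K]
    (φ : G →* PGL(2, K)) {g : G} (hg : φ g ≠ 1) :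
    ∃ N : Subgroup G, N.Normal ∧ N.FiniteIndex ∧ g ∉ N := by
  obtain ⟨S, hS⟩ := Group.fg_def.1 ‹Group.FG G›
  choose A hA using fun s : G => ProjGenLinGroup.mk_surjective (φ s)
  -- The entries of the inverses are included so that the generators are invertible over `R`.
  let E : Set K := ⋃ s : S, Set.range (fun q : Fin 2 × Fin 2 => A s q.1 q.2) ∪
    Set.range (fun q : Fin 2 × Fin 2 => (A s)⁻¹ q.1 q.2)
  have hE : E.Finite :=
    Set.finite_iUnion fun s => (Set.finite_range _).union (Set.finite_range _)
  let R : Subalgebra ℤ K := Algebra.adjoin ℤ E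
  have hR : Algebra.FiniteType ℤ R :=
    .adjoin_of_finite hE
  let μ : PGL(2, R) →* PGL(2, K) := ProjGenLinGroup.map (algebraMap R K)
  have hμ : Function.Injective μ := projGenLinGroup_map_injective _ Subtype.val_injective
  have hrange : ∀ x, φ x ∈ μ.range := by
    have hle : Subgroup.closure (S : Set G) ≤ μ.range.comap φ := by
      rw [Subgroup.closure_le]
      intro s hs
      have hsub : ∀ y ∈ Set.range (fun q : Fin 2 × Fin 2 => A s q.1 q.2) ∪
          Set.range (fun q : Fin 2 × Fin 2 => (A s)⁻¹ q.1 q.2), y ∈ R := fun y hy =>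
        Algebra.subset_adjoin (Set.mem_iUnion.2 ⟨⟨s, hs⟩, hy⟩)
      obtain ⟨B, hB⟩ := mem_range_generalLinearGroup_map R (A s)
        (fun i j => hsub _ (Or.inl ⟨(i, j), rfl⟩)) (fun i j => hsub _ (Or.inr ⟨(i, j), rfl⟩))
      refine ⟨ProjGenLinGroup.mk B, ?_⟩
      rw [ProjGenLinGroup.map_mk, hB, hA]
    intro x
    exact hle (hS ▸ Subgroup.mem_top x)
  let ψ : G →* PGL(2, R) :=
    (MonoidHom.ofInjective hμ).symm.toMonoidHom.comp (φ.codRestrict μ.range hrange)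
  have hψ : ψ g ≠ 1 := by
    intro h
    apply hg
    have : φ.codRestrict μ.range hrange g = 1 :=
      (MonoidHom.ofInjective hμ).symm.injective (h.trans (map_one _).symm)
    exact congrArg Subtype.val this
  obtain ⟨m, hm, hgm⟩ := exists_hom_finite_projGenLinGroup hψ
  let χ : G →* PGL(2, R ⧸ m) := (ProjGenLinGroup.map (Ideal.Quotient.mk m)).comp ψ
  have : Finite (GL (Fin 2) (R ⧸ m)) := inferInstance
  have : Finite PGL(2, R ⧸ m) := Finite.of_surjective _ ProjGenLinGroup.mk_surjective
  exact ⟨χ.ker, inferInstance, Subgroup.finiteIndex_ker χ, hgm⟩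

end ResidualFiniteness

end Plectic

theorem mainTheorem5
    {k : Type*} [NontriviallyNormedField k] [IsUltrametricDist k] [ProperSpace k]
    {S : Type*} [Finite S] (F : S → Type*) [∀ i, Field (F i)] [∀ i, ValuativeRel (F i)]
    [∀ i, TopologicalSpace (F i)] [∀ i, IsNonarchimedeanLocalField (F i)]
    (ι : ∀ i, F i →+* Plectic.CompletedAlgClosure k) (hι : ∀ i, Continuous (ι i))
    (Γ : Subgroup (∀ i, PGL(2, F i))) (hΓ : Plectic.IsNormalPlectic ι Γ) :
    Plectic.IsVirtuallyTorsionFree Γ ∧ Plectic.IsTypeWFL Γ := by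
  obtain ⟨L, hplectic, hss, hfin⟩ := hΓ
  have h := hplectic.isProperCocompact hι
    (fun i => Plectic.exists_notMem_range_completedAlgClosure (ι i) (hι i)) hfin
  choose p hp using fun i : {i // (L i).Nonempty} => Plectic.exists_isParentMap i.2
  have hX : ∀ i : {i // (L i).Nonempty}, (Plectic.limitTree (L i)).Nonempty := fun i =>
    Plectic.limitTree_nonempty i.2 (hss i)
  have hfg := h.fg hp hX
  have hres : ∀ γ : Γ, γ ≠ 1 → ∃ N : Subgroup Γ, N.Normal ∧ N.FiniteIndex ∧ γ ∉ N := by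
    intro γ hγ
    -- This coordinate ranges over all of `S`; `L i` may be empty.
    obtain ⟨i, hi⟩ : ∃ i, (γ : ∀ i, PGL(2, F i)) i ≠ 1 := by
      by_contra! hall
      exact hγ (Subtype.ext (funext hall))
    exact Plectic.exists_normal_finiteIndex_notMem
      ((Pi.evalMonoidHom (fun i => PGL(2, F i)) i).comp Γ.subtype) hi
  exact ⟨h.isVirtuallyTorsionFree hp hX hres, h.isTypeWFL hp hX hres⟩
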